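/- Let $\lambda>0$ and $R\ge 0$ be real numbers. Let $H=\begin{pmatrix}1&0\\0&-1\end{pmatrix}$, $X=\begin{pmatrix}0&1\\0&0\end{pmatrix}$, $Y=\begin{pmatrix}0&0\\1&0\end{pmatrix}$ be the standard basis of $\mathfrak{sl}_2(\mathbb C)$ and let $\mathbb S^2_\lambda=\{k\mu k^{-1} : k\in SU(2)\}$ be the adjoint orbit of $SU(2)$ through $\mu=\frac{\mathrm i\lambda}{8}H$, with projection $\psi\colon SU(2)\to\mathbb S^2_\lambda$, $k\mapsto k\mu k^{-1}$. Let $\mathrm{Pol}(\mathbb S^2_\lambda)$ be the algebra of restrictions to $\mathbb S^2_\lambda$ of complex valued polynomials on $\mathfrak{su}(2)$. Star product. Put $\Omega=\{0,\lambda,\frac\lambda2,\frac\lambda3,\dots\}$. For $\hbar\in\mathbb C\setminus\Omega$ and $p,q\in\mathrm{Pol}(\mathbb S^2_\lambda)$ let $p*_\hbar q\in\mathrm{Pol}(\mathbb S^2_\lambda)$ be determined by $$(p*_\hbar q)\circ\psi=\sum_{n=0}^\infty\frac{(-1)^n\hbar^n}{n!\,\lambda(\lambda-\hbar)\cdots(\lambda-(n-1)\hbar)}\,\bigl((Y^{\mathrm{left}})^n(p\circ\psi)\bigr)\cdot\bigl((X^{\mathrm{left}})^n(q\circ\psi)\bigr),$$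 where $Z\mapsto Z^{\mathrm{left}}$ is the complex linear extension to $\mathfrak{sl}_2(\mathbb C)$ of the map that sends $E\in\mathfrak{su}(2)$ to the left invariant vector field $f\mapsto\bigl(k\mapsto\frac{\mathrm d}{\mathrm dt}\big|_{t=0}f(k\exp(tE))\bigr)$ on $SU(2)$; only finitely many terms of the sum are non-zero. Topology. Let $\hat U,\hat{\overline U},\hat V,\hat{\overline V}$ be the functions $z_1,\overline z_1,z_2,\overline z_2$ on $\mathbb C^2$ and give the algebra of polynomials in them the locally convex topology of the seminorms $\sum_I a_I e^I\mapsto\sum_I(|I|!)^R\,C^{|I|}\,|a_I|$, $C\ge1$, where $e^I$ ($I\in\mathbb N_0^4$) are the monomials in these generators. Give the subalgebra generated by $\hat U\hat{\overline U}-\hat V\hat{\overline V}$, $\hat{\overline U}\hat V$, $\hat U\hat{\overline V}$, $\hat U\hat{\overline U}+\hat V\hat{\overline V}$ the subspace topology, and give its image under restriction to $SU(2)$ (a matrix in $SU(2)$ is sent to its first column in $\mathbb C^2$) the quotient topology. This image is the space of all $p\circ\psi$ with $p\in\mathrm{Pol}(\mathbb S^2_\lambda)$; the resulting topology on $\mathrm{Pol}(\mathbb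 S^2_\lambda)$ is the reduction-$T_R$-topology. Let $\widehat{\mathrm{Pol}}_R(\mathbb S^2_\lambda)$ be the completion. For every $\hbar\in\mathbb C\setminus\Omega$ the product $*_\hbar$ is well defined on $\mathrm{Pol}(\mathbb S^2_\lambda)$ and extends to a continuous map $*_\hbar\colon\widehat{\mathrm{Pol}}_R(\mathbb S^2_\lambda)\times\widehat{\mathrm{Pol}}_R(\mathbb S^2_\lambda)\to\widehat{\mathrm{Pol}}_R(\mathbb S^2_\lambda)$, and for every $x\in\mathbb S^2_\lambda$ the evaluation $p\mapsto p(x)$ extends to a continuous map $\widehat{\mathrm{Pol}}_R(\mathbb S^2_\lambda)\to\mathbb C$, still written $p\mapsto p(x)$. With these extensions, for all $p,q\in\widehat{\mathrm{Pol}}_R(\mathbb S^2_\lambda)$ and all $x\in\mathbb S^2_\lambda$ the function $$\mathbb C\setminus\Omega\to\mathbb C,\qquad \hbar\mapsto(p*_\hbar q)(x)$$ is holomorphic. -/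

import Mathlib

open scoped Matrix Topology

noncomputable section

namespace QuantumSphere

/-! ## The group `SU(2)`, its Lie algebra and left invariant vector fields -/

/-- The group `SU(2)`. -/
abbrev SU2 : Type := Matrix.specialUnitaryGroup (Fin 2) ℂ

/-- The real Lie algebra `su(2)` of trace-free skew-Hermitian `2 × 2` matrices. -/
def su2 : Submodule ℝ (Matrix (Fin 2) (Fin 2) ℂ) where
  carrier := {E | Eᴴ = -E ∧ E.trace = 0}
  zero_mem' := by simp
  add_mem' := by
    rintro E F ⟨hE, hE'⟩ ⟨hF, hF'⟩
    exact ⟨by rw [Matrix.conjTranspose_add, hE, hF]; abel, by simp [hE', hF']⟩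
  smul_mem' := by
    rintro c E ⟨hE, hE'⟩
    exact ⟨by rw [Matrix.conjTranspose_smul, hE]; simp, by simp [hE']⟩

/-- The exponential of a trace-free `2 × 2` matrix has determinant one. -/
theorem det_exp_eq_one (Z : Matrix (Fin 2) (Fin 2) ℂ) (hZ : Z.trace = 0) :
    (NormedSpace.exp Z).det = 1 := by
  set J : Matrix (Fin 2) (Fin 2) ℂ := !![0, 1; -1, 0] with hJ
  have hJdet : J.det = 1 := by simp [hJ, Matrix.det_fin_two]
  have hJunit : IsUnit J := by rw [Matrix.isUnit_iff_isUnit_det, hJdet]; exact isUnit_one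
  have hJinv : J⁻¹ = !![0, -1; 1, 0] := by
    apply Matrix.inv_eq_right_inv
    ext i j; fin_cases i <;> fin_cases j <;> simp [hJ]
  have adj : ∀ A : Matrix (Fin 2) (Fin 2) ℂ, J * Aᵀ * J⁻¹ = A.adjugate := by
    intro A
    rw [hJinv, Matrix.adjugate_fin_two, Matrix.eta_fin_two A, hJ]
    ext i j; fin_cases i <;> fin_cases j <;> simp [Matrix.mul_apply, Matrix.vecMul, dotProduct, Fin.sum_univ_two]
  have hneg : J * Zᵀ * J⁻¹ = -Z := by
    rw [adj, Matrix.adjugate_fin_two]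
    rw [Matrix.trace_fin_two] at hZ
    ext i j; fin_cases i <;> fin_cases j <;> simp
    · linear_combination hZ
    · linear_combination hZ
  have h1 : (NormedSpace.exp Z).adjugate = (NormedSpace.exp Z)⁻¹ := by
    rw [← adj, ← Matrix.exp_transpose, ← Matrix.exp_conj _ _ hJunit, hneg, Matrix.exp_neg]
  have h2 := Matrix.mul_adjugate (NormedSpace.exp Z)
  rw [h1, Matrix.mul_nonsing_inv _
    ((Matrix.isUnit_iff_isUnit_det _).1 (Matrix.isUnit_exp Z))] at h2
  have h3 := congrFun (congrFun h2 0) 0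
  simpa using h3.symm

/-- The exponential map `su(2) → SU(2)`. -/
def expSU (E : su2) : SU2 :=
  ⟨NormedSpace.exp (E : Matrix (Fin 2) (Fin 2) ℂ), by
    rw [Matrix.mem_specialUnitaryGroup_iff]
    refine ⟨?_, det_exp_eq_one _ E.2.2⟩
    rw [Matrix.mem_unitaryGroup_iff, Matrix.star_eq_conjTranspose, ← Matrix.exp_conjTranspose,
      E.2.1, Matrix.exp_neg]
    exact Matrix.mul_nonsing_inv _
      ((Matrix.isUnit_iff_isUnit_det _).1 (Matrix.isUnit_exp _))⟩

/-- The left invariant vector field on `SU(2)` of `E ∈ su(2)`: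
`f ↦ (k ↦ d/dt f (k exp(tE)) at t = 0)`. -/
def leftField (E : su2) (f : SU2 → ℂ) (k : SU2) : ℂ :=
  deriv (fun t : ℝ => f (k * expSU (t • E))) 0

/-- The part `E = (Z - Z*) / 2 ∈ su(2)` in the decomposition `Z = E + i F` of `Z ∈ sl(2, ℂ)`. -/
def partE (Z : Matrix (Fin 2) (Fin 2) ℂ) (hZ : Z.trace = 0) : su2 :=
  ⟨(1 / 2 : ℂ) • (Z - Zᴴ), by simp [Matrix.conjTranspose_smul, ← smul_neg], by
    simp [Matrix.trace_smul, Matrix.trace_conjTranspose, hZ]⟩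

/-- The part `F = -i (Z + Z*) / 2 ∈ su(2)` in the decomposition `Z = E + i F`
of `Z ∈ sl(2, ℂ)`. -/
def partF (Z : Matrix (Fin 2) (Fin 2) ℂ) (hZ : Z.trace = 0) : su2 :=
  ⟨(-Complex.I / 2) • (Z + Zᴴ), by
    rw [Matrix.conjTranspose_smul, ← neg_smul, Matrix.conjTranspose_add,
      Matrix.conjTranspose_conjTranspose, add_comm Zᴴ Z]
    congr 1
    simp [neg_div], by
    simp [Matrix.trace_smul, Matrix.trace_conjTranspose, hZ]⟩

theorem partE_add_I_smul_partF (Z : Matrix (Fin 2) (Fin 2) ℂ) (hZ : Z.trace = 0) :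
    (partE Z hZ : Matrix (Fin 2) (Fin 2) ℂ) + Complex.I • (partF Z hZ).1 = Z := by
  have h : Complex.I * (-Complex.I / 2) = 1 / 2 := by
    rw [mul_div_assoc', mul_neg, Complex.I_mul_I]; norm_num
  simp only [partE, partF, smul_smul, h, ← smul_add]
  rw [sub_add_add_cancel, ← two_smul ℂ Z, smul_smul]; norm_num

/-- The left invariant vector field of `Z = E + i F ∈ sl(2, ℂ)`, `E, F ∈ su(2)`, extended
complex linearly from `su(2)`. -/
def leftFieldC (Z : Matrix (Fin 2) (Fin 2) ℂ) (hZ : Z.trace = 0) (f : SU2 → ℂ) : SU2 → ℂ :=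
  fun k => leftField (partE Z hZ) f k + Complex.I * leftField (partF Z hZ) f k

/-- The left invariant vector field of the basis element `X` of `sl(2, ℂ)`. -/
def leftX : (SU2 → ℂ) → (SU2 → ℂ) :=
  leftFieldC !![0, 1; 0, 0] (by simp [Matrix.trace_fin_two])

/-- The left invariant vector field of the basis element `Y` of `sl(2, ℂ)`. -/
def leftY : (SU2 → ℂ) → (SU2 → ℂ) :=
  leftFieldC !![0, 0; 1, 0] (by simp [Matrix.trace_fin_two])

/-! ## The sphere as an adjoint orbit and its polynomial functions -/

/-- The base point `μ = (i l / 8) H`, for which `B(-iμ, H) = l`, where `B(Z, W) = 4 tr(ZW)` is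
the Killing form of `sl(2, ℂ)`. -/
def basePoint (l : ℝ) : Matrix (Fin 2) (Fin 2) ℂ :=
  (Complex.I * (l : ℂ) / 8) • !![1, 0; 0, -1]

/-- The adjoint orbit of `SU(2)` through `μ`. -/
def Sphere (l : ℝ) : Set (Matrix (Fin 2) (Fin 2) ℂ) :=
  Set.range fun k : SU2 =>
    (k : Matrix (Fin 2) (Fin 2) ℂ) * basePoint l * ((k⁻¹ : SU2) : Matrix (Fin 2) (Fin 2) ℂ)

/-- The orbit projection `ψ : SU(2) → Sphere`, `k ↦ Ad_k μ`. -/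
def psi (l : ℝ) (k : SU2) : Sphere l :=
  ⟨(k : Matrix (Fin 2) (Fin 2) ℂ) * basePoint l * ((k⁻¹ : SU2) : Matrix (Fin 2) (Fin 2) ℂ),
    k, rfl⟩

/-- The restrictions to the sphere of complex valued polynomials on the real vector space that
contains it: the algebra of functions generated by the (restrictions of) real linear maps
with values in `ℂ`. -/
def Pol (l : ℝ) : Subalgebra ℂ (Sphere l → ℂ) :=
  Algebra.adjoin ℂ {f | ∃ φ : Matrix (Fin 2) (Fin 2) ℂ →ₗ[ℝ] ℂ, ∀ x : Sphere l, f x = φ x}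

/-- The right invariant extension `p ∘ ψ` of a function on the sphere to `SU(2)`. -/
def pull (l : ℝ) : (Sphere l → ℂ) →ₐ[ℂ] (SU2 → ℂ) where
  toFun p := p ∘ psi l
  map_one' := rfl
  map_mul' _ _ := rfl
  map_zero' := rfl
  map_add' _ _ := rfl
  commutes' _ := rfl

/-! ## The star product on polynomials -/

/-- The set of poles `{0, l, l/2, l/3, …}`. -/
def poleSet (l : ℝ) : Set ℂ := {0} ∪ {h | ∃ n : ℕ, 1 ≤ n ∧ h = (l : ℂ) / (n : ℂ)}

/-- The coefficient of `Y ^ n ⊗ X ^ n` in `F_ħ`: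
`(-1) ^ n ħ ^ n / (n! l (l - ħ) ⋯ (l - (n - 1) ħ))`. -/
def starCoeff (l : ℝ) (h : ℂ) (n : ℕ) : ℂ :=
  (-1) ^ n * h ^ n / ((n.factorial : ℂ) * ∏ j ∈ Finset.range n, ((l : ℂ) - (j : ℂ) * h))

/-- `F_ħ(p, q)` as a function on `SU(2)`: the bidifferential operator
`∑ n, starCoeff n • Y ^ n ⊗ X ^ n` applied to the right invariant extensions of `p` and `q`.
For polynomials only finitely many terms are non-zero. -/
def starLift (l : ℝ) (h : ℂ) (p q : Pol l) (k : SU2) : ℂ :=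
  ∑' n : ℕ, starCoeff l h n * (leftY^[n] (pull l p)) k * (leftX^[n] (pull l q)) k

open Classical in
/-- The star product `p *_ħ q` of polynomials on the sphere: the polynomial whose right invariant
extension to `SU(2)` is `F_ħ(p, q)`. -/
def starProd (l : ℝ) (h : ℂ) (p q : Pol l) : Pol l :=
  if hr : ∃ r : Pol l, pull l r = starLift l h p q then hr.choose else 0

/-! ## The reduction topology -/

/-- The coordinate functions `U, Ū, V, V̄` on `SU(2)`, where `u, v` are the entries of the first
column. -/
def coord : Fin 4 → SU2 → ℂ :=
  ![fun k => k.1 0 0, fun k => star (k.1 0 0), fun k => k.1 1 0, fun k => star (k.1 1 0)]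

/-- `A = U Ū - V V̄` on `SU(2)`. -/
def fA : SU2 → ℂ := coord 0 * coord 1 - coord 2 * coord 3
/-- `B = Ū V` on `SU(2)`. -/
def fB : SU2 → ℂ := coord 1 * coord 2
/-- `C = U V̄` on `SU(2)`. -/
def fC : SU2 → ℂ := coord 0 * coord 3

/-- The algebra of functions on `SU(2)` generated by `A, B, C`. -/
def InvSU : Subalgebra ℂ (SU2 → ℂ) := Algebra.adjoin ℂ {fA, fB, fC}

/-- The algebra of complex polynomials on the real vector space `ℂ²`, i.e. the symmetric algebra on
the basis `Û, Û̄, V̂, V̂̄` (in this order) of its complexified dual. -/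
abbrev PolC2 : Type := MvPolynomial (Fin 4) ℂ

/-- `Â = Û Û̄ - V̂ V̂̄` on `ℂ²`. -/
def hA : PolC2 := .X 0 * .X 1 - .X 2 * .X 3
/-- `B̂ = Û̄ V̂` on `ℂ²`. -/
def hB : PolC2 := .X 1 * .X 2
/-- `Ĉ = Û V̂̄` on `ℂ²`. -/
def hC : PolC2 := .X 0 * .X 3
/-- `D̂ = Û Û̄ + V̂ V̂̄` on `ℂ²`. -/
def hD : PolC2 := .X 0 * .X 1 + .X 2 * .X 3

/-- The algebra generated by `Â, B̂, Ĉ, D̂`. -/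
def InvC2 : Subalgebra ℂ PolC2 := Algebra.adjoin ℂ {hA, hB, hC, hD}

/-- Restriction of a polynomial on `ℂ²` to `SU(2)`, seen as the unit sphere via the first
column. -/
def restrict : PolC2 →ₐ[ℂ] (SU2 → ℂ) := MvPolynomial.aeval coord

theorem restrict_hD : restrict hD = 1 := by
  funext k
  have h := (Matrix.mem_unitaryGroup_iff'.1 (Matrix.mem_specialUnitaryGroup_iff.1 k.2).1)
  have h0 := congrFun (congrFun h 0) 0
  simp only [Matrix.mul_apply, Fin.sum_univ_two, Matrix.star_apply, Matrix.one_apply_eq] at h0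
  simp only [restrict, hD, coord, map_add, map_mul, MvPolynomial.aeval_X, Pi.add_apply,
    Pi.mul_apply, Pi.one_apply]
  simpa [mul_comm] using h0

theorem map_restrict_InvC2 : InvC2.map restrict = InvSU := by
  have hA' : restrict hA = fA := by simp [restrict, hA, fA]
  have hB' : restrict hB = fB := by simp [restrict, hB, fB]
  have hC' : restrict hC = fC := by simp [restrict, hC, fC]
  rw [InvC2, AlgHom.map_adjoin, InvSU]
  simp only [Set.image_insert_eq, Set.image_singleton, hA', hB', hC', restrict_hD]
  apply le_antisymm
  · apply Algebra.adjoin_le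
    rintro f (rfl | rfl | rfl | rfl)
    · exact Algebra.subset_adjoin (by simp)
    · exact Algebra.subset_adjoin (by simp)
    · exact Algebra.subset_adjoin (by simp)
    · exact one_mem _
  · apply Algebra.adjoin_mono
    rintro f (rfl | rfl | rfl) <;> simp

/-- The restriction map from the algebra generated by `Â, B̂, Ĉ, D̂` to the one generated by
`A, B, C`. -/
def restrictInv : InvC2 →ₐ[ℂ] InvSU :=
  (restrict.comp InvC2.val).codRestrict InvSU fun P => by
    rw [← map_restrict_InvC2]
    exact ⟨P, P.2, rfl⟩

theorem restrictInv_surjective : Function.Surjective restrictInv := by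
  rintro ⟨f, hf⟩
  obtain ⟨P, hP, rfl⟩ := (map_restrict_InvC2 ▸ hf : f ∈ InvC2.map restrict)
  exact ⟨⟨P, hP⟩, rfl⟩

theorem pull_mem_InvSU (l : ℝ) (p : Pol l) : pull l p ∈ InvSU := by
  have key : Pol l ≤ InvSU.comap (pull l) := by
    apply Algebra.adjoin_le
    rintro f ⟨φ, hφ⟩
    have hlin : ∀ (c : SU2 → ℂ) (M : Matrix (Fin 2) (Fin 2) ℂ),
        (fun k => ((c k).re : ℂ)) ∈ InvSU → (fun k => ((c k).im : ℂ)) ∈ InvSU →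
        (fun k => φ (c k • M)) ∈ InvSU := by
      intro c M hre him
      have : (fun k => φ (c k • M)) =
          φ M • (fun k => ((c k).re : ℂ)) + φ (Complex.I • M) • (fun k => ((c k).im : ℂ)) := by
        funext k
        have h1 : c k • M = (c k).re • M + (c k).im • (Complex.I • M) := by
          conv_lhs => rw [← Complex.re_add_im (c k)]
          ext i j
          simp only [Matrix.smul_apply, Matrix.add_apply, smul_eq_mul, Complex.real_smul]
          ring
        rw [h1, map_add, map_smul, map_smul]
        simp [mul_comm]
      rw [this]
      exact add_mem (InvSU.smul_mem hre _) (InvSU.smul_mem him _)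
    have mA : fA ∈ InvSU := Algebra.subset_adjoin (by simp)
    have mB : fB ∈ InvSU := Algebra.subset_adjoin (by simp)
    have mC : fC ∈ InvSU := Algebra.subset_adjoin (by simp)
    have hconj : ∀ k, fC k = star (fB k) := by intro k; simp [fB, fC, coord]
    have hAre : ∀ k, ((fA k).re : ℂ) = fA k := by
      intro k
      apply Complex.conj_eq_iff_re.1
      simp [fA, coord, mul_comm]
    have hAim : ∀ k, (fA k).im = 0 := by
      intro k
      apply Complex.conj_eq_iff_im.1
      simp [fA, coord, mul_comm]
    have mre : (fun k => ((fB k).re : ℂ)) ∈ InvSU := by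
      have : (fun k => ((fB k).re : ℂ)) = (1 / 2 : ℂ) • (fB + fC) := by
        funext k
        have := hconj k
        simp only [Pi.smul_apply, Pi.add_apply, this, smul_eq_mul]
        rw [Complex.re_eq_add_conj]
        simp; ring
      rw [this]
      exact InvSU.smul_mem (add_mem mB mC) _
    have mim : (fun k => ((fB k).im : ℂ)) ∈ InvSU := by
      have : (fun k => ((fB k).im : ℂ)) = (1 / (2 * Complex.I) : ℂ) • (fB - fC) := by
        funext k
        have := hconj k
        simp only [Pi.smul_apply, Pi.sub_apply, this, smul_eq_mul]
        rw [Complex.im_eq_sub_conj, div_eq_inv_mul, one_div]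
        rfl
      rw [this]
      exact InvSU.smul_mem (sub_mem mB mC) _
    have mre' : (fun k => ((fC k).re : ℂ)) ∈ InvSU := by
      have : (fun k => ((fC k).re : ℂ)) = fun k => ((fB k).re : ℂ) := by
        funext k; rw [hconj]; simp
      rw [this]; exact mre
    have mim' : (fun k => ((fC k).im : ℂ)) ∈ InvSU := by
      have : (fun k => ((fC k).im : ℂ)) = -fun k => ((fB k).im : ℂ) := by
        funext k; rw [hconj]; simp
      rw [this]; exact neg_mem mim
    have mreA : (fun k => ((fA k).re : ℂ)) ∈ InvSU := by
      have : (fun k => ((fA k).re : ℂ)) = fA := funext hAre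
      rw [this]; exact mA
    have mimA : (fun k => ((fA k).im : ℂ)) ∈ InvSU := by
      have : (fun k => ((fA k).im : ℂ)) = 0 := by funext k; simp [hAim]
      rw [this]; exact zero_mem _
    set c : ℂ := Complex.I * (l : ℂ) / 8 with hc
    have hpsi : ∀ k, ((psi l k : Sphere l) : Matrix (Fin 2) (Fin 2) ℂ) =
        fA k • (c • !![1, 0; 0, -1]) + fB k • (c • !![0, 0; 2, 0])
          + fC k • (c • !![0, 2; 0, 0]) := by
      intro k
      have hinv : ((k⁻¹ : SU2) : Matrix (Fin 2) (Fin 2) ℂ) = k.1.adjugate := by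
        have h1 : (k : Matrix (Fin 2) (Fin 2) ℂ) * ((k⁻¹ : SU2) : Matrix (Fin 2) (Fin 2) ℂ) = 1 := by
          rw [← Submonoid.coe_mul, mul_inv_cancel]; rfl
        have h2 := Matrix.adjugate_mul k.1
        rw [(Matrix.mem_specialUnitaryGroup_iff.1 k.2).2, one_smul] at h2
        exact (left_inv_eq_right_inv h2 h1).symm
      have hst : k.1ᴴ = k.1.adjugate := by rw [← hinv]; rfl
      rw [Matrix.adjugate_fin_two] at hst
      have e1 : star (k.1 0 0) = k.1 1 1 := by
        simpa using congrFun (congrFun hst 0) 0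
      have e2 : star (k.1 1 0) = -k.1 0 1 := by
        simpa using congrFun (congrFun hst 0) 1
      have f0 : fA k = k.1 0 0 * k.1 1 1 + k.1 1 0 * k.1 0 1 := by
        rw [← e1, ← neg_neg (k.1 0 1), ← e2]; simp [fA, coord, sub_eq_add_neg]
      have f1 : fB k = k.1 1 1 * k.1 1 0 := by rw [← e1]; simp [fB, coord]
      have f2 : fC k = -(k.1 0 0 * k.1 0 1) := by
        rw [← neg_neg (k.1 0 1), ← e2]; simp [fC, coord]
      simp only [psi, hinv, basePoint, f0, f1, f2, ← hc]
      rw [Matrix.adjugate_fin_two]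
      ext i j
      fin_cases i <;> fin_cases j <;>
        simp [Matrix.mul_apply, Fin.sum_univ_two] <;> ring
    have : pull l f = (fun k => φ (fA k • (c • !![1, 0; 0, -1])))
        + (fun k => φ (fB k • (c • !![0, 0; 2, 0]))) + fun k => φ (fC k • (c • !![0, 2; 0, 0])) := by
      funext k
      change f (psi l k) = _
      rw [hφ, hpsi]
      simp only [map_add, Pi.add_apply]
    change pull l f ∈ InvSU
    rw [this]
    exact add_mem (add_mem (hlin _ _ mreA mimA) (hlin _ _ mre mim)) (hlin _ _ mre' mim')
  exact key p.2

/-- The pull-back `Pol → InvSU`, `p ↦ p ∘ ψ`. It is an isomorphism for `l ≠ 0`. -/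
def pullPol (l : ℝ) : Pol l →ₐ[ℂ] InvSU :=
  ((pull l).comp (Pol l).val).codRestrict InvSU fun p => pull_mem_InvSU l p

/-- The seminorm `∑ a_I e ^ I ↦ ∑ (|I|!) ^ R * C ^ |I| * |a_I|` on the symmetric algebra, for
`C ≥ 1`. This is `(C ‖·‖)_R` for the 1-norm of the basis `Û, Û̄, V̂, V̂̄`. -/
def trSeminorm (R : ℝ) (C : Set.Ici (1 : ℝ)) : Seminorm ℂ PolC2 :=
  Seminorm.of
    (fun P => ∑ I ∈ P.support, ((I.degree.factorial : ℝ) ^ R * (C : ℝ) ^ I.degree) * ‖P.coeff I‖)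
    (by
      intro P Q
      classical
      have hC : (0 : ℝ) ≤ C := zero_le_one.trans C.2
      have ext : ∀ S : PolC2, S.support ⊆ P.support ∪ Q.support →
          ∑ I ∈ S.support, ((I.degree.factorial : ℝ) ^ R * (C : ℝ) ^ I.degree) * ‖S.coeff I‖ =
          ∑ I ∈ P.support ∪ Q.support,
            ((I.degree.factorial : ℝ) ^ R * (C : ℝ) ^ I.degree) * ‖S.coeff I‖ := by
        intro S hS
        apply Finset.sum_subset hS
        intro I _ hI
        rw [MvPolynomial.notMem_support_iff.1 hI]
        simp
      rw [ext _ MvPolynomial.support_add, ext P Finset.subset_union_left,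
        ext Q Finset.subset_union_right, ← Finset.sum_add_distrib]
      apply Finset.sum_le_sum
      intro I _
      rw [← mul_add, MvPolynomial.coeff_add]
      exact mul_le_mul_of_nonneg_left (norm_add_le _ _) (by positivity))
    (by
      intro c P
      rw [Finset.mul_sum]
      by_cases hc : c = 0
      · simp [hc]
      · have hs : (c • P).support = P.support := by
          ext I; simp [MvPolynomial.mem_support_iff, hc]
        rw [hs]
        apply Finset.sum_congr rfl
        intro I _
        rw [MvPolynomial.coeff_smul, norm_smul]
        ring)

/-- The `T_R`-topology on the polynomials on `ℂ²`: the locally convex topology of the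
seminorms `trSeminorm R C`, `C ≥ 1`. -/
@[reducible] def trTopology (R : ℝ) : TopologicalSpace PolC2 :=
  SeminormFamily.moduleFilterBasis (trSeminorm R) |>.topology

/-- The subspace topology on the algebra generated by `Â, B̂, Ĉ, D̂`. -/
@[reducible] def subTopology (R : ℝ) : TopologicalSpace InvC2 :=
  (trTopology R).induced Subtype.val

/-- The quotient topology on the algebra of functions on `SU(2)` generated by `A, B, C`. -/
@[reducible] def quotTopology (R : ℝ) : TopologicalSpace InvSU :=
  (subTopology R).coinduced restrictInv

/-- The reduction-`T_R`-topology, transported to polynomials on the sphere. -/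
@[reducible] def reductionTopology (l R : ℝ) : TopologicalSpace (Pol l) :=
  (quotTopology R).induced (pullPol l)

theorem isTopologicalAddGroup_sub (R : ℝ) :
    @IsTopologicalAddGroup InvC2 (subTopology R) _ := by
  let : TopologicalSpace PolC2 := trTopology R
  have : IsTopologicalAddGroup PolC2 :=
    (SeminormFamily.moduleFilterBasis (trSeminorm R)).toAddGroupFilterBasis.isTopologicalAddGroup
  exact topologicalAddGroup_induced (InvC2.val : InvC2 →ₐ[ℂ] PolC2)

theorem isTopologicalAddGroup_quot (R : ℝ) :
    @IsTopologicalAddGroup InvSU (quotTopology R) _ := by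
  let : TopologicalSpace InvC2 := subTopology R
  have : IsTopologicalAddGroup InvC2 := isTopologicalAddGroup_sub R
  let : TopologicalSpace InvSU := quotTopology R
  have hq : Topology.IsQuotientMap restrictInv :=
    ⟨⟨rfl⟩, restrictInv_surjective⟩
  have hopen : IsOpenMap restrictInv := by
    intro S hS
    rw [← hq.isOpen_preimage]
    have : restrictInv ⁻¹' (restrictInv '' S) =
        ⋃ g ∈ {g : InvC2 | restrictInv g = 0}, (fun x => g + x) ⁻¹' S := by
      ext x
      simp only [Set.mem_preimage, Set.mem_image, Set.mem_iUnion, Set.mem_ofPred_eq]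
      constructor
      · rintro ⟨y, hy, hxy⟩
        exact ⟨y - x, by rw [map_sub, hxy, sub_self], by simpa using hy⟩
      · rintro ⟨g, hg, hx⟩
        exact ⟨g + x, hx, by rw [map_add, hg, zero_add]⟩
    rw [this]
    exact isOpen_biUnion fun g _ => hS.preimage (continuous_const.add continuous_id)
  have ho : IsOpenQuotientMap restrictInv := ⟨restrictInv_surjective, hq.continuous, hopen⟩
  refine @IsTopologicalAddGroup.mk _ _ _ ⟨?_⟩ ⟨?_⟩
  · rw [(ho.prodMap ho).continuous_comp_iff.symm]
    have : (fun p : InvSU × InvSU => p.1 + p.2) ∘ Prod.map restrictInv restrictInv =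
        restrictInv ∘ fun p : InvC2 × InvC2 => p.1 + p.2 := by
      funext p; simp
    rw [this]
    exact ho.continuous.comp continuous_add
  · rw [ho.continuous_comp_iff.symm]
    have : (fun p : InvSU => -p) ∘ restrictInv = restrictInv ∘ fun p : InvC2 => -p := by
      funext p; simp
    rw [this]
    exact ho.continuous.comp continuous_neg

/-- The vector space of polynomials on the sphere, endowed with the reduction-`T_R`-topology. -/
def PolTR (l _R : ℝ) : Type := Pol l

instance (l R : ℝ) : AddCommGroup (PolTR l R) := inferInstanceAs (AddCommGroup (Pol l))

instance (l R : ℝ) : Module ℂ (PolTR l R) := inferInstanceAs (Module ℂ (Pol l))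

instance (l R : ℝ) : TopologicalSpace (PolTR l R) := reductionTopology l R

instance (l R : ℝ) : IsTopologicalAddGroup (PolTR l R) :=
  letI : TopologicalSpace InvSU := quotTopology R
  haveI : IsTopologicalAddGroup InvSU := isTopologicalAddGroup_quot R
  topologicalAddGroup_induced (pullPol l : Pol l →ₐ[ℂ] InvSU)

instance (l R : ℝ) : UniformSpace (PolTR l R) :=
  IsTopologicalAddGroup.rightUniformSpace (PolTR l R)

instance (l R : ℝ) : IsUniformAddGroup (PolTR l R) := isUniformAddGroup_of_addCommGroup

/-- A polynomial on the sphere as an element of the topological vector space `PolTR`. -/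
def PolTR.of (l R : ℝ) (p : Pol l) : PolTR l R := p

/-- The polynomial underlying an element of `PolTR`. -/
def PolTR.toPol {l R : ℝ} (p : PolTR l R) : Pol l := p

/-! ## The completion -/

/-- The completion of the polynomials on the sphere in the reduction-`T_R`-topology. -/
abbrev PolHat (l R : ℝ) : Type := UniformSpace.Completion (PolTR l R)

/-- The canonical map of the polynomials into their completion. -/
def toHat (l R : ℝ) (p : Pol l) : PolHat l R :=
  (PolTR.of l R p : UniformSpace.Completion (PolTR l R))

/-- The extension by continuity of the star product `*_ħ` to the completion. -/
def starHat (l R : ℝ) (h : ℂ) (p q : PolHat l R) : PolHat l R :=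
  ((UniformSpace.Completion.isDenseInducing_coe (α := PolTR l R)).prodMap
      (UniformSpace.Completion.isDenseInducing_coe (α := PolTR l R))).extend
    (fun pq : PolTR l R × PolTR l R => toHat l R (starProd l h pq.1.toPol pq.2.toPol)) (p, q)

/-- The extension by continuity of the evaluation `p ↦ p(x)` to the completion. -/
def evalHat (l R : ℝ) (x : Sphere l) (p : PolHat l R) : ℂ :=
  (UniformSpace.Completion.isDenseInducing_coe (α := PolTR l R)).extend
    (fun p : PolTR l R => p.toPol.1 x) p

end QuantumSphere

end

noncomputable section

namespace QuantumSphere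

open MvPolynomial

/-! The fields of `X` and `Y` act on `z₁, z̄₁, z₂, z̄₂` by linear substitutions, so they lift to
degree preserving derivations `polyX`, `polyY` of `PolC2`. The star product therefore lifts to a
bidifferential operator `polyStar` on polynomials on `ℂ²`, where it can be estimated on monomials.

Two bounds meet. Differentiating a monomial of degree `d` a total of `n` times costs at most `d ^ n`
in the `ℓ¹`-norm of the coefficients. Away from the poles `|l - jħ|` grows at least linearly in `j`,
so the `n`-th coefficient is at most `M ^ n / (n!)²`, with one `M` for a whole closed disc of
parameters (`exists_norm_starCoeff_le`). For monomials of degrees `a`, `b` the series is then at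
most `exp (M a) * exp b`, which is geometric in the degrees and is absorbed by enlarging the
constant `C` of the seminorm (`exists_bidiff_le`). This gives joint continuity on `PolC2`. It passes
to the invariant subalgebra, which is the part of circle weight zero, and then to `Pol l`, because
`InvC2 → Pol l` is an open quotient map (`isOpenQuotientMap_toPol`). Being biadditive, the product
extends to the completion.

For holomorphy, fix a point `x` and a closed disc `K` that avoids the poles. The same estimate, with
values in `C(K, ℂ)`, shows that sending `(p, q)` to the function `ħ ↦ (p *_ħ q)(x)` on `K` is
continuous for the sup norm, so it extends to the completion as well. The extended functions are
thus uniform limits on `K` of finite sums of the rational functions `starCoeff l ħ n`, and uniform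
limits of holomorphic functions are holomorphic. -/

/-! ## Left invariant vector fields on polynomials -/

/-- The derivation of the polynomials on `ℂ²` that extends the left invariant vector field of
`Z ∈ sl(2, ℂ)`. -/
def polyField (Z : Matrix (Fin 2) (Fin 2) ℂ) : Derivation ℂ PolC2 PolC2 :=
  mkDerivation ℂ ![Z 0 0 • X 0 - Z 1 0 • X 3, Z 0 1 • X 2 - Z 0 0 • X 1,
    Z 0 0 • X 2 + Z 1 0 • X 1, -(Z 0 0 • X 3) - Z 0 1 • X 0]

/-- The polynomial extension of the vector field `leftX`. -/
def polyX : Derivation ℂ PolC2 PolC2 := mkDerivation ℂ ![0, X 2, 0, -X 0]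

/-- The polynomial extension of the vector field `leftY`. -/
def polyY : Derivation ℂ PolC2 PolC2 := mkDerivation ℂ ![-X 3, 0, X 1, 0]

theorem polyField_add_I_smul (A B : Matrix (Fin 2) (Fin 2) ℂ) :
    polyField (A + Complex.I • B) = polyField A + Complex.I • polyField B := by
  apply derivation_ext
  intro i
  fin_cases i <;>
    simp [polyField, mkDerivation_X, add_smul, smul_sub, mul_smul] <;> abel

theorem polyField_X : polyField !![0, 1; 0, 0] = polyX := by
  apply derivation_ext
  intro i
  fin_cases i <;> simp [polyField, polyX, mkDerivation_X]

theorem polyField_Y : polyField !![0, 0; 1, 0] = polyY := by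
  apply derivation_ext
  intro i
  fin_cases i <;> simp [polyField, polyY, mkDerivation_X]

/-- Each Leibniz term trades one factor `X i` of weight `w i` for `f i` of weight `w i + c`. The
weights are left general because three gradings are used: total degree, circle weight, and the
degree in `z₁, z₂` alone. -/
theorem isWeightedHomogeneous_mkDerivation {M : Type*} [AddCommMonoid M] {w : Fin 4 → M} {c m : M}
    {f : Fin 4 → PolC2} (hf : ∀ i, (f i).IsWeightedHomogeneous w (w i + c)) {P : PolC2}
    (hP : P.IsWeightedHomogeneous w m) :
    (mkDerivation ℂ f P).IsWeightedHomogeneous w (m + c) := by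
  rw [P.as_sum, map_sum]
  refine IsWeightedHomogeneous.sum _ _ _ fun s hs => ?_
  rw [mkDerivation_monomial, Finsupp.sum]
  refine Submodule.smul_mem (weightedHomogeneousSubmodule ℂ w _) _ ?_
  refine Submodule.sum_mem _ fun i hi => ?_
  have hle : Finsupp.single i 1 ≤ s := by
    rw [Finsupp.single_le_iff]
    exact Nat.one_le_iff_ne_zero.2 (Finsupp.mem_support_iff.1 hi)
  have hw : Finsupp.weight w (s - Finsupp.single i 1) + w i = m := by
    rw [← hP (mem_support_iff.1 hs)]
    conv_rhs => rw [← tsub_add_cancel_of_le hle, map_add, Finsupp.weight_single, one_smul]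
  rw [← hw, add_assoc, mem_weightedHomogeneousSubmodule, smul_eq_mul]
  exact (isWeightedHomogeneous_monomial w _ _ rfl).mul (hf i)

theorem isHomogeneous_polyX {P : PolC2} {m : ℕ} (hP : P.IsHomogeneous m) :
    (polyX P).IsHomogeneous m := by
  refine isWeightedHomogeneous_mkDerivation (c := 0) (fun i => ?_) hP
  fin_cases i
  · exact isHomogeneous_zero _ _ _
  · exact isHomogeneous_X _ _
  · exact isHomogeneous_zero _ _ _
  · exact (isHomogeneous_X _ _).neg

theorem isHomogeneous_polyY {P : PolC2} {m : ℕ} (hP : P.IsHomogeneous m) :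
    (polyY P).IsHomogeneous m := by
  refine isWeightedHomogeneous_mkDerivation (c := 0) (fun i => ?_) hP
  fin_cases i
  · exact (isHomogeneous_X _ _).neg
  · exact isHomogeneous_zero _ _ _
  · exact isHomogeneous_X _ _
  · exact isHomogeneous_zero _ _ _

/-- The weights of the circle action on `ℂ²`. -/
def circleWeight : Fin 4 → ℤ := ![1, -1, 1, -1]

theorem isWeightedHomogeneous_polyX {P : PolC2} {m : ℤ}
    (hP : P.IsWeightedHomogeneous circleWeight m) :
    (polyX P).IsWeightedHomogeneous circleWeight (m + 2) := by
  refine isWeightedHomogeneous_mkDerivation (fun i => ?_) hP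
  fin_cases i
  · exact isWeightedHomogeneous_zero _ _ _
  · exact isWeightedHomogeneous_X _ _ _
  · exact isWeightedHomogeneous_zero _ _ _
  · exact (isWeightedHomogeneous_X _ circleWeight _).neg

theorem isWeightedHomogeneous_polyY {P : PolC2} {m : ℤ}
    (hP : P.IsWeightedHomogeneous circleWeight m) :
    (polyY P).IsWeightedHomogeneous circleWeight (m + (-2)) := by
  refine isWeightedHomogeneous_mkDerivation (fun i => ?_) hP
  fin_cases i
  · exact (isWeightedHomogeneous_X _ circleWeight _).neg
  · exact isWeightedHomogeneous_zero _ _ _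
  · exact isWeightedHomogeneous_X _ _ _
  · exact isWeightedHomogeneous_zero _ _ _

/-! ## Invariant polynomials -/

theorem weight_circleWeight (I : Fin 4 →₀ ℕ) :
    Finsupp.weight circleWeight I = (I 0 : ℤ) + I 2 - I 1 - I 3 := by
  rw [Finsupp.weight_apply, Finsupp.sum_fintype _ _ (by simp)]
  simp [Fin.sum_univ_four, circleWeight]
  ring

theorem X_mul_X_mem_InvC2 {i j : Fin 4} (hi : i = 0 ∨ i = 2) (hj : j = 1 ∨ j = 3) :
    (X i * X j : PolC2) ∈ InvC2 := by
  have mA : hA ∈ InvC2 := Algebra.subset_adjoin (by simp)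
  have mB : hB ∈ InvC2 := Algebra.subset_adjoin (by simp)
  have mC : hC ∈ InvC2 := Algebra.subset_adjoin (by simp)
  have mD : hD ∈ InvC2 := Algebra.subset_adjoin (by simp)
  rcases hi with rfl | rfl <;> rcases hj with rfl | rfl
  -- `z₁ z̄₁ = (D̂ + Â) / 2`; the last case is `z₂ z̄₂ = (D̂ - Â) / 2`.
  · convert InvC2.smul_mem (add_mem mD mA) (1 / 2 : ℂ) using 1
    rw [hA, hD, add_add_sub_cancel, ← two_smul ℂ, smul_smul]
    norm_num
  · exact mC
  · rw [mul_comm]; exact mB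
  · convert InvC2.smul_mem (sub_mem mD mA) (1 / 2 : ℂ) using 1
    rw [hA, hD, add_sub_sub_cancel, ← two_smul ℂ, smul_smul]
    norm_num

/-- With as many holomorphic as antiholomorphic factors, the factors can be split off in pairs, one
of each kind, and every such pair is invariant. -/
theorem monomial_mem_InvC2 (d : ℕ) : ∀ I : Fin 4 →₀ ℕ, I 0 + I 2 = d → I 1 + I 3 = d →
    (monomial I 1 : PolC2) ∈ InvC2 := by
  induction d with
  | zero =>
    intro I h1 h2
    have : I = 0 := by
      ext i
      fin_cases i <;> simp <;> omega
    rw [this]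
    exact one_mem _
  | succ d ih =>
    intro I h1 h2
    have hi : ∃ i : Fin 4, (i = 0 ∨ i = 2) ∧ I i ≠ 0 := by
      by_cases h : I 0 = 0
      · exact ⟨2, by simp, by omega⟩
      · exact ⟨0, by simp, h⟩
    have hj : ∃ j : Fin 4, (j = 1 ∨ j = 3) ∧ I j ≠ 0 := by
      by_cases h : I 1 = 0
      · exact ⟨3, by simp, by omega⟩
      · exact ⟨1, by simp, h⟩
    obtain ⟨i, hi, hi0⟩ := hi
    obtain ⟨j, hj, hj0⟩ := hj
    have hI : I = (I - Finsupp.single i 1 - Finsupp.single j 1) +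
        (Finsupp.single i 1 + Finsupp.single j 1) := by
      ext k
      rcases hi with rfl | rfl <;> rcases hj with rfl | rfl <;> fin_cases k <;> simp <;> omega
    have hm : (monomial I 1 : PolC2) =
        monomial (I - Finsupp.single i 1 - Finsupp.single j 1) 1 * (X i * X j) := by
      conv_lhs => rw [hI]
      simp [X, monomial_mul]
    rw [hm]
    refine mul_mem (ih _ ?_ ?_) (X_mul_X_mem_InvC2 hi hj)
    · rcases hi with rfl | rfl <;> rcases hj with rfl | rfl <;> simp <;> omega
    · rcases hi with rfl | rfl <;> rcases hj with rfl | rfl <;> simp <;> omega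

/-- Replaces membership in a generated algebra by a weight count, which is easy to follow through
`polyX` and `polyY`. -/
theorem mem_InvC2_iff {P : PolC2} : P ∈ InvC2 ↔ P.IsWeightedHomogeneous circleWeight 0 := by
  constructor
  · intro hP
    have hX : ∀ i j : Fin 4, circleWeight i + circleWeight j = 0 →
        (X i * X j : PolC2).IsWeightedHomogeneous circleWeight 0 := fun i j h =>
      h ▸ (isWeightedHomogeneous_X _ _ i).mul (isWeightedHomogeneous_X _ _ j)
    refine Algebra.adjoin_induction (p := fun P _ => P.IsWeightedHomogeneous circleWeight 0)
      ?_ ?_ ?_ ?_ hP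
    · rintro P (rfl | rfl | rfl | rfl)
      · exact (hX _ _ (by simp [circleWeight])).sub (hX _ _ (by simp [circleWeight]))
      · exact hX _ _ (by simp [circleWeight])
      · exact hX _ _ (by simp [circleWeight])
      · exact (hX _ _ (by simp [circleWeight])).add (hX _ _ (by simp [circleWeight]))
    · exact fun c => isWeightedHomogeneous_C _ c
    · exact fun P Q _ _ hP hQ => hP.add hQ
    · exact fun P Q _ _ hP hQ => by simpa using hP.mul hQ
  · intro hP
    rw [P.as_sum]
    refine sum_mem fun I hI => ?_
    have h := hP (mem_support_iff.1 hI)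
    rw [weight_circleWeight] at h
    have := InvC2.smul_mem (monomial_mem_InvC2 (I 0 + I 2) I rfl (by omega)) (P.coeff I)
    rwa [smul_monomial, smul_eq_mul, mul_one] at this

/-! ## Norm estimates -/

theorem trSeminorm_apply (R : ℝ) (C : Set.Ici (1 : ℝ)) (P : PolC2) : trSeminorm R C P =
    ∑ I ∈ P.support, ((I.degree.factorial : ℝ) ^ R * (C : ℝ) ^ I.degree) * ‖P.coeff I‖ := rfl

theorem trSeminorm_monomial (R : ℝ) (C : Set.Ici (1 : ℝ)) (I : Fin 4 →₀ ℕ) (c : ℂ) :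
    trSeminorm R C (monomial I c) =
      ((I.degree.factorial : ℝ) ^ R * (C : ℝ) ^ I.degree) * ‖c‖ := by
  classical
  rw [trSeminorm_apply]
  by_cases hc : c = 0
  · simp [hc]
  · rw [support_monomial, if_neg hc]
    simp

/-- A linear map is bounded by a `T_R`-seminorm as soon as it is so on monomials. -/
theorem seminorm_le_trSeminorm {E : Type*} [AddCommGroup E] [Module ℂ E] (q : Seminorm ℂ E)
    (F : PolC2 →ₗ[ℂ] E) (R : ℝ) (C : Set.Ici (1 : ℝ)) (K : ℝ)
    (hF : ∀ I, q (F (monomial I 1)) ≤ K * trSeminorm R C (monomial I 1)) (P : PolC2) :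
    q (F P) ≤ K * trSeminorm R C P := by
  conv_lhs => rw [P.as_sum, map_sum]
  refine (Finset.le_sum_of_subadditive q (map_zero q).le (map_add_le_add q) _ _).trans ?_
  rw [trSeminorm_apply, Finset.mul_sum]
  refine Finset.sum_le_sum fun I _ => ?_
  have : (monomial I (P.coeff I) : PolC2) = P.coeff I • monomial I 1 := by
    rw [smul_monomial, smul_eq_mul, mul_one]
  rw [this, map_smul, map_smul_eq_mul]
  have h := mul_le_mul_of_nonneg_left (hF I) (norm_nonneg (P.coeff I))
  rw [trSeminorm_monomial, norm_one, mul_one] at h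
  linarith

/-- The sum of the absolute values of the coefficients. -/
def coeffNorm : Seminorm ℂ PolC2 := trSeminorm 0 ⟨1, Set.self_mem_Ici⟩

theorem coeffNorm_apply (P : PolC2) : coeffNorm P = ∑ I ∈ P.support, ‖P.coeff I‖ := by
  simp [coeffNorm, trSeminorm_apply]

theorem coeffNorm_monomial (I : Fin 4 →₀ ℕ) (c : ℂ) : coeffNorm (monomial I c) = ‖c‖ := by
  simp [coeffNorm, trSeminorm_monomial]

theorem trSeminorm_of_isHomogeneous (R : ℝ) (C : Set.Ici (1 : ℝ)) {P : PolC2} {m : ℕ}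
    (hP : P.IsHomogeneous m) :
    trSeminorm R C P = (m.factorial : ℝ) ^ R * (C : ℝ) ^ m * coeffNorm P := by
  rw [trSeminorm_apply, coeffNorm_apply, Finset.mul_sum]
  refine Finset.sum_congr rfl fun I hI => ?_
  have h : I.degree = m := by
    by_contra h
    exact mem_support_iff.1 hI (hP.coeff_eq_zero h)
  rw [h]

/-- A linear map is bounded by the sum of absolute values as soon as it is so on monomials. -/
theorem seminorm_le_coeffNorm {E : Type*} [AddCommGroup E] [Module ℂ E] (q : Seminorm ℂ E)
    (F : PolC2 →ₗ[ℂ] E) (K : ℝ) (P : PolC2) (hF : ∀ I ∈ P.support, q (F (monomial I 1)) ≤ K) :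
    q (F P) ≤ K * coeffNorm P := by
  conv_lhs => rw [P.as_sum, map_sum]
  refine (Finset.le_sum_of_subadditive q (map_zero q).le (map_add_le_add q) _ _).trans ?_
  rw [coeffNorm_apply, Finset.mul_sum]
  refine Finset.sum_le_sum fun I hI => ?_
  have : (monomial I (P.coeff I) : PolC2) = P.coeff I • monomial I 1 := by
    rw [smul_monomial, smul_eq_mul, mul_one]
  rw [this, map_smul, map_smul_eq_mul, mul_comm]
  exact mul_le_mul_of_nonneg_right (hF I hI) (norm_nonneg (P.coeff I))

theorem coeffNorm_mul_le (P Q : PolC2) : coeffNorm (P * Q) ≤ coeffNorm P * coeffNorm Q := by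
  have h1 : ∀ (I : Fin 4 →₀ ℕ) (Q : PolC2), coeffNorm (monomial I 1 * Q) ≤ coeffNorm Q := by
    intro I Q
    refine (seminorm_le_coeffNorm coeffNorm (LinearMap.mulLeft ℂ (monomial I 1)) 1 Q
      fun J _ => ?_).trans (one_mul _).le
    simp [monomial_mul, coeffNorm_monomial]
  rw [mul_comm (coeffNorm P)]
  exact seminorm_le_coeffNorm coeffNorm (LinearMap.mulRight ℂ Q) _ P fun I _ => h1 I Q

/-- On a monomial the exponents appear as Leibniz factors, and they add up to the degree `m`. -/
theorem coeffNorm_mkDerivation_le {f : Fin 4 → PolC2} (hf : ∀ i, coeffNorm (f i) ≤ 1) {P : PolC2}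
    {m : ℕ} (hP : P.IsHomogeneous m) : coeffNorm (mkDerivation ℂ f P) ≤ m * coeffNorm P := by
  refine seminorm_le_coeffNorm coeffNorm (mkDerivation ℂ f).toLinearMap m P fun I hI => ?_
  have h : I.degree = m := by
    by_contra h
    exact mem_support_iff.1 hI (hP.coeff_eq_zero h)
  rw [Derivation.coeFn_coe, mkDerivation_monomial, one_smul, Finsupp.sum]
  refine (Finset.le_sum_of_subadditive coeffNorm (map_zero _).le (map_add_le_add _) _ _).trans ?_
  rw [← h, Finsupp.degree_apply, Nat.cast_sum]
  refine Finset.sum_le_sum fun i _ => ?_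
  rw [smul_eq_mul]
  refine (coeffNorm_mul_le _ _).trans ?_
  rw [coeffNorm_monomial, Complex.norm_natCast]
  exact mul_le_of_le_one_right (Nat.cast_nonneg _) (hf i)

theorem coeffNorm_X (i : Fin 4) : coeffNorm (X i) = 1 := by
  rw [X, coeffNorm_monomial, norm_one]

theorem polyX_iterate_monomial (I : Fin 4 →₀ ℕ) (n : ℕ) :
    (polyX^[n] (monomial I 1)).IsHomogeneous I.degree ∧
      coeffNorm (polyX^[n] (monomial I 1)) ≤ (I.degree : ℝ) ^ n := by
  induction n with
  | zero => exact ⟨isHomogeneous_monomial _ rfl, by simp [coeffNorm_monomial]⟩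
  | succ n ih =>
    rw [Function.iterate_succ_apply', pow_succ']
    refine ⟨isHomogeneous_polyX ih.1, (coeffNorm_mkDerivation_le (fun i => ?_) ih.1).trans
      (mul_le_mul_of_nonneg_left ih.2 (Nat.cast_nonneg _))⟩
    fin_cases i <;> simp [coeffNorm_X, map_neg_eq_map]

theorem polyY_iterate_monomial (I : Fin 4 →₀ ℕ) (n : ℕ) :
    (polyY^[n] (monomial I 1)).IsHomogeneous I.degree ∧
      coeffNorm (polyY^[n] (monomial I 1)) ≤ (I.degree : ℝ) ^ n := by
  induction n with
  | zero => exact ⟨isHomogeneous_monomial _ rfl, by simp [coeffNorm_monomial]⟩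
  | succ n ih =>
    rw [Function.iterate_succ_apply', pow_succ']
    refine ⟨isHomogeneous_polyY ih.1, (coeffNorm_mkDerivation_le (fun i => ?_) ih.1).trans
      (mul_le_mul_of_nonneg_left ih.2 (Nat.cast_nonneg _))⟩
    fin_cases i <;> simp [coeffNorm_X, map_neg_eq_map]

/-! ## Bidifferential operators of infinite order -/

theorem derivation_iterate (D : Derivation ℂ PolC2 PolC2) (n : ℕ) (P : PolC2) :
    D^[n] P = (D.toLinearMap ^ n : Module.End ℂ PolC2) P :=
  (Module.End.pow_apply _ _ _).symm

theorem derivation_iterate_smul (D : Derivation ℂ PolC2 PolC2) (n : ℕ) (c : ℂ) (P : PolC2) :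
    D^[n] (c • P) = c • D^[n] P := by
  simp only [derivation_iterate, map_smul]

/-- `polyY` sends `z₁, z₂` to `-z̄₂, z̄₁` and kills `z̄₁, z̄₂`, so it lowers the degree in `z₁, z₂`
by one. The grading takes values in `ℤ` so that the resulting negative degree can be stated and
refuted. -/
theorem polyY_iterate_monomial_eq_zero {I : Fin 4 →₀ ℕ} {n : ℕ} (hn : I.degree < n) :
    polyY^[n] (monomial I 1) = 0 := by
  have hw : ∀ J : Fin 4 →₀ ℕ,
      Finsupp.weight (![1, 0, 1, 0] : Fin 4 → ℤ) J = (J 0 : ℤ) + J 2 := by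
    intro J
    rw [Finsupp.weight_apply, Finsupp.sum_fintype _ _ (by simp)]
    simp [Fin.sum_univ_four]
  have key : ∀ n : ℕ, (polyY^[n] (monomial I 1)).IsWeightedHomogeneous
      (![1, 0, 1, 0] : Fin 4 → ℤ) ((I 0 : ℤ) + I 2 + n * (-1)) := by
    intro n
    induction n with
    | zero => exact isWeightedHomogeneous_monomial _ _ _ (by simp [hw])
    | succ n ih =>
      rw [Function.iterate_succ_apply', Nat.cast_succ, add_mul, one_mul, ← add_assoc]
      refine isWeightedHomogeneous_mkDerivation (fun i => ?_) ih
      fin_cases i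
      · exact (isWeightedHomogeneous_X _ (![1, 0, 1, 0] : Fin 4 → ℤ) _).neg
      · exact isWeightedHomogeneous_zero _ _ _
      · exact isWeightedHomogeneous_X _ _ _
      · exact isWeightedHomogeneous_zero _ _ _
  by_contra h
  obtain ⟨J, hJ⟩ := exists_coeff_ne_zero h
  have h1 := key n hJ
  rw [hw] at h1
  rw [Finsupp.degree_eq_sum, Fin.sum_univ_four] at hn
  omega

theorem polyY_iterate_eq_zero {P : PolC2} {n : ℕ} (hn : P.totalDegree < n) :
    polyY^[n] P = 0 := by
  have h : ∀ I ∈ P.support, polyY^[n] (monomial I (P.coeff I)) = 0 := by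
    intro I hI
    have : (monomial I (P.coeff I) : PolC2) = P.coeff I • monomial I 1 := by
      rw [smul_monomial, smul_eq_mul, mul_one]
    rw [this, derivation_iterate_smul, polyY_iterate_monomial_eq_zero, smul_zero]
    rw [Finsupp.degree_apply]
    exact (le_totalDegree hI).trans_lt hn
  rw [P.as_sum, derivation_iterate, map_sum]
  simp only [← derivation_iterate]
  exact Finset.sum_eq_zero h

variable {E : Type*} [AddCommGroup E] [Module ℂ E]

theorem bidiff_support_subset (T : ℕ → PolC2 →ₗ[ℂ] E) (P Q : PolC2) {N : ℕ}
    (hN : P.totalDegree < N) :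
    (Function.support fun n => T n (polyY^[n] P * polyX^[n] Q)) ⊆ Finset.range N := by
  intro n hn
  rw [Finset.coe_range, Set.mem_Iio]
  by_contra h
  exact hn (by simp [polyY_iterate_eq_zero (hN.trans_le (not_lt.1 h))])

/-- The bilinear operator `(P, Q) ↦ ∑ n, T n (Y ^ n P * X ^ n Q)`. -/
def bidiff (T : ℕ → PolC2 →ₗ[ℂ] E) : PolC2 →ₗ[ℂ] PolC2 →ₗ[ℂ] E :=
  have hfin : ∀ P Q, (Function.support fun n => T n (polyY^[n] P * polyX^[n] Q)).Finite :=
    fun P Q => (Finset.finite_toSet _).subset (bidiff_support_subset T P Q (Nat.lt_succ_self _))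
  LinearMap.mk₂ ℂ (fun P Q => ∑ᶠ n, T n (polyY^[n] P * polyX^[n] Q))
    (fun P P' Q => by
      rw [← finsum_add_distrib (hfin _ _) (hfin _ _)]
      simp only [iterate_map_add, add_mul, map_add])
    (fun c P Q => by
      rw [smul_finsum]
      simp only [derivation_iterate_smul, smul_mul_assoc, map_smul])
    (fun P Q Q' => by
      rw [← finsum_add_distrib (hfin _ _) (hfin _ _)]
      simp only [iterate_map_add, mul_add, map_add])
    (fun c P Q => by
      rw [smul_finsum]
      simp only [derivation_iterate_smul, mul_smul_comm, map_smul])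

theorem bidiff_apply (T : ℕ → PolC2 →ₗ[ℂ] E) (P Q : PolC2) {N : ℕ} (hN : P.totalDegree < N) :
    bidiff T P Q = ∑ n ∈ Finset.range N, T n (polyY^[n] P * polyX^[n] Q) :=
  finsum_eq_sum_of_support_subset _ (bidiff_support_subset T P Q hN)

theorem factorial_add_le (a b : ℕ) :
    ((a + b).factorial : ℝ) ≤ 2 ^ (a + b) * (a.factorial * b.factorial) := by
  rw [← Nat.add_choose_mul_factorial_mul_factorial a b]
  have h : ((a + b).choose b : ℝ) ≤ 2 ^ (a + b) := by exact_mod_cast Nat.choose_le_two_pow _ _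
  push_cast
  rw [mul_assoc]
  exact mul_le_mul_of_nonneg_right h (by positivity)

/-- One factorial goes to each power: `b ^ n / n!` is bounded termwise by `exp b`, and the remaining
sum is a partial sum of `exp (M * a)`. -/
theorem sum_div_factorial_sq_le {M a b : ℝ} (hM : 0 ≤ M) (ha : 0 ≤ a) (hb : 0 ≤ b) (N : ℕ) :
    ∑ n ∈ Finset.range N, M ^ n / (n.factorial : ℝ) ^ 2 * (a ^ n * b ^ n) ≤
      Real.exp (M * a) * Real.exp b := by
  have h1 : ∑ n ∈ Finset.range N, M ^ n / (n.factorial : ℝ) ^ 2 * (a ^ n * b ^ n) =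
      ∑ n ∈ Finset.range N, (M * a) ^ n / (n.factorial : ℝ) * (b ^ n / n.factorial) := by
    refine Finset.sum_congr rfl fun n _ => ?_
    rw [mul_pow]
    ring
  rw [h1]
  refine (Finset.sum_le_sum (g := fun n : ℕ => (M * a) ^ n / (n.factorial : ℝ) * Real.exp b)
    fun n _ => mul_le_mul_of_nonneg_left (Real.pow_div_factorial_le_exp b hb n)
      (by positivity)).trans ?_
  rw [← Finset.sum_mul]
  exact mul_le_mul_of_nonneg_right (Real.sum_le_exp_of_nonneg (by positivity) N)
    (Real.exp_pos _).le

/-- The central estimate. The target `E` is arbitrary so that it serves both for a fixed `ħ`, with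
`E = PolC2`, and for all `ħ` in a compact set at once, with `E = C(K, ℂ)`. -/
theorem exists_bidiff_le {R : ℝ} (hR : 0 ≤ R) (T : ℕ → PolC2 →ₗ[ℂ] E) (q : Seminorm ℂ E) {M : ℝ}
    (hM : 0 ≤ M) (C : Set.Ici (1 : ℝ))
    (hT : ∀ n P, q (T n P) ≤ M ^ n / (n.factorial : ℝ) ^ 2 * trSeminorm R C P) :
    ∃ C' : Set.Ici (1 : ℝ), ∀ P Q, q (bidiff T P Q) ≤ trSeminorm R C' P * trSeminorm R C' Q := by
  have hC : (1 : ℝ) ≤ C := C.2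
  have hC0 : (0 : ℝ) ≤ C := zero_le_one.trans hC
  have h2 : (1 : ℝ) ≤ 2 ^ R := Real.one_le_rpow (by norm_num) hR
  have hexp : (1 : ℝ) ≤ Real.exp (M + 1) := Real.one_le_exp (by positivity)
  -- The factor `2 ^ R` pays for splitting `(a + b)! ^ R`, the factor `C` for the degree `a + b` of
  -- the products, and `exp (M + 1)` for `M a + b ≤ (M + 1)(a + b)`.
  have hC1 : 1 ≤ 2 ^ R * C * Real.exp (M + 1) :=
    one_le_mul_of_one_le_of_one_le (one_le_mul_of_one_le_of_one_le h2 hC) hexp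
  obtain ⟨C', hC'⟩ : ∃ C' : Set.Ici (1 : ℝ), (C' : ℝ) = 2 ^ R * C * Real.exp (M + 1) :=
    ⟨⟨_, hC1⟩, rfl⟩
  refine ⟨C', fun P Q => ?_⟩
  have key : ∀ I J : Fin 4 →₀ ℕ, q (bidiff T (monomial I 1) (monomial J 1)) ≤
      trSeminorm R C' (monomial I 1) * trSeminorm R C' (monomial J 1) := by
    intro I J
    set a := I.degree
    set b := J.degree
    rw [bidiff_apply T _ _ (Nat.lt_succ_self _)]
    set w : ℝ := ((a + b).factorial : ℝ) ^ R * (C : ℝ) ^ (a + b) with hw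
    have hw0 : 0 ≤ w := by positivity
    have hterm : ∀ n, q (T n (polyY^[n] (monomial I 1) * polyX^[n] (monomial J 1))) ≤
        w * (M ^ n / (n.factorial : ℝ) ^ 2 * ((a : ℝ) ^ n * (b : ℝ) ^ n)) := by
      intro n
      obtain ⟨hY, hY'⟩ := polyY_iterate_monomial I n
      obtain ⟨hX, hX'⟩ := polyX_iterate_monomial J n
      refine (hT n _).trans ?_
      rw [trSeminorm_of_isHomogeneous R C (hY.mul hX), mul_left_comm w]
      refine mul_le_mul_of_nonneg_left ?_ (by positivity)
      refine mul_le_mul_of_nonneg_left ?_ hw0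
      exact (coeffNorm_mul_le _ _).trans
        (mul_le_mul hY' hX' (apply_nonneg _ _) (by positivity))
    refine (Finset.le_sum_of_subadditive q (map_zero q).le (map_add_le_add q) _ _).trans ?_
    refine (Finset.sum_le_sum fun n _ => hterm n).trans ?_
    rw [← Finset.mul_sum]
    refine (mul_le_mul_of_nonneg_left (sum_div_factorial_sq_le hM (Nat.cast_nonneg a)
      (Nat.cast_nonneg b) _) hw0).trans ?_
    rw [trSeminorm_monomial, trSeminorm_monomial, norm_one, mul_one, mul_one]
    have e1 : Real.exp (M * a) * Real.exp b ≤ Real.exp (M + 1) ^ (a + b) := by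
      rw [← Real.exp_add, ← Real.exp_nat_mul]
      refine Real.exp_le_exp.2 ?_
      push_cast
      have : 0 ≤ M * b := by positivity
      have : (0 : ℝ) ≤ a := by positivity
      linarith
    have e2 : ((a + b).factorial : ℝ) ^ R ≤
        (2 ^ R) ^ (a + b) * ((a.factorial : ℝ) ^ R * (b.factorial : ℝ) ^ R) := by
      refine (Real.rpow_le_rpow (by positivity) (factorial_add_le a b) hR).trans_eq ?_
      rw [Real.mul_rpow (by positivity) (by positivity),
        Real.mul_rpow (by positivity) (by positivity), Real.rpow_pow_comm (by norm_num)]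
    calc w * (Real.exp (M * a) * Real.exp b)
        ≤ ((2 ^ R) ^ (a + b) * ((a.factorial : ℝ) ^ R * (b.factorial : ℝ) ^ R) *
          (C : ℝ) ^ (a + b)) * Real.exp (M + 1) ^ (a + b) := by
          refine mul_le_mul ?_ e1 (by positivity) (by positivity)
          exact mul_le_mul_of_nonneg_right e2 (by positivity)
      _ = _ := by
          rw [hC']
          simp only [mul_pow, pow_add]
          ring
  -- The `T_R`-seminorms are weighted `ℓ¹`-norms, so the bound on pairs of monomials extends
  -- linearly, one variable at a time.
  refine (seminorm_le_trSeminorm q ((bidiff T).flip Q) R C' (trSeminorm R C' Q)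
    (fun I => ?_) P).trans (mul_comm _ _).le
  rw [LinearMap.flip_apply]
  refine (seminorm_le_trSeminorm q (bidiff T (monomial I 1)) R C' (trSeminorm R C' (monomial I 1))
    (fun J => key I J) Q).trans (mul_comm _ _).le

theorem withSeminorms_trTopology (R : ℝ) :
    @WithSeminorms ℂ PolC2 _ _ _ _ (trSeminorm R) (trTopology R) :=
  @WithSeminorms.mk ℂ PolC2 _ _ _ _ (trSeminorm R) (trTopology R) rfl

/-- A bilinear map that is bounded by products of the `T_R`-seminorms is jointly continuous. -/
theorem continuous_of_le_trSeminorm [TopologicalSpace E] {κ : Type*} {q : SeminormFamily ℂ E κ}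
    (hq : WithSeminorms q) (R : ℝ) (F : PolC2 →ₗ[ℂ] PolC2 →ₗ[ℂ] E)
    (hF : ∀ i, ∃ C, ∀ P Q, q i (F P Q) ≤ trSeminorm R C P * trSeminorm R C Q) :
    letI := trTopology R
    Continuous fun z : PolC2 × PolC2 => F z.1 z.2 := by
  let _ : TopologicalSpace PolC2 := trTopology R
  have hs := withSeminorms_trTopology R
  have : IsTopologicalAddGroup PolC2 := hs.topologicalAddGroup
  refine continuous_iff_continuousAt.2 fun z₀ => (hq.tendsto_nhds _ _).2 fun i ε hε => ?_
  obtain ⟨C, hC⟩ := hF i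
  have hc : Continuous (trSeminorm R C) := hs.continuous_seminorm C
  have hlim : Filter.Tendsto (fun z : PolC2 × PolC2 =>
      trSeminorm R C (z.1 - z₀.1) * trSeminorm R C z.2 +
        trSeminorm R C z₀.1 * trSeminorm R C (z.2 - z₀.2)) (𝓝 z₀) (𝓝 0) := by
    have h : Continuous (fun z : PolC2 × PolC2 =>
      trSeminorm R C (z.1 - z₀.1) * trSeminorm R C z.2 +
        trSeminorm R C z₀.1 * trSeminorm R C (z.2 - z₀.2)) := by fun_prop
    simpa using h.tendsto z₀
  filter_upwards [hlim.eventually (gt_mem_nhds hε)] with z hz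
  have e : F z.1 z.2 - F z₀.1 z₀.2 = F (z.1 - z₀.1) z.2 + F z₀.1 (z.2 - z₀.2) := by
    simp
  rw [e]
  exact ((map_add_le_add _ _ _).trans (add_le_add (hC _ _) (hC _ _))).trans_lt hz

/-! ## The coefficients of the star product -/

/-- The poles form a convergent sequence together with its limit `0`. Closedness makes the distance
from a regular parameter to the poles positive. -/
theorem isClosed_poleSet (l : ℝ) : IsClosed (poleSet l) := by
  have h : poleSet l = insert 0 (Set.range fun n : ℕ => (l : ℂ) / ((n + 1 : ℕ) : ℂ)) := by
    ext z
    simp only [poleSet, Set.singleton_union, Set.mem_insert_iff, Set.mem_ofPred_eq, Set.mem_range]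
    refine or_congr_right ⟨?_, ?_⟩
    · rintro ⟨n, hn, rfl⟩
      exact ⟨n - 1, by rw [Nat.sub_add_cancel hn]⟩
    · rintro ⟨n, rfl⟩
      exact ⟨n + 1, by omega, rfl⟩
  rw [h]
  refine IsCompact.isClosed (Filter.Tendsto.isCompact_insert_range ?_)
  exact (tendsto_const_div_atTop_nhds_zero_nat (𝕜 := ℂ) _).comp (Filter.tendsto_add_atTop_nat 1)

theorem sub_mul_ne_zero {l : ℝ} (hl : 0 < l) {h : ℂ} (hh : h ∉ poleSet l) (j : ℕ) :
    (l : ℂ) - j * h ≠ 0 := by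
  intro h0
  rcases Nat.eq_zero_or_pos j with rfl | hj
  · exact hl.ne' (by simpa using h0)
  · refine hh (Or.inr ⟨j, hj, ?_⟩)
    rw [eq_div_iff (Nat.cast_ne_zero.2 hj.ne'), mul_comm, ← sub_eq_zero.1 h0]

theorem differentiableAt_starCoeff {l : ℝ} (hl : 0 < l) (n : ℕ) {h : ℂ} (hh : h ∉ poleSet l) :
    DifferentiableAt ℂ (fun h => starCoeff l h n) h := by
  unfold starCoeff
  refine DifferentiableAt.fun_div (by fun_prop) (by fun_prop) ?_
  exact mul_ne_zero (Nat.cast_ne_zero.2 n.factorial_ne_zero)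
    (Finset.prod_ne_zero_iff.2 fun j _ => sub_mul_ne_zero hl hh j)

/-- For `j ≥ 1` the left-out factor is `j` times the distance from `h` to the pole `l / j`, and `j +
1 ≤ 2 * j` accounts for `δ / 2`; the entry `l` of the minimum covers `j = 0`. The linear growth in
`j` yields the second factorial in the coefficient bound. -/
theorem le_norm_sub_mul {l δ : ℝ} (hl : 0 < l) {h : ℂ} (hδ : δ ≤ Metric.infDist h (poleSet l))
    (j : ℕ) : min l (δ / 2) * (j + 1) ≤ ‖(l : ℂ) - j * h‖ := by
  rcases Nat.eq_zero_or_pos j with rfl | hj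
  · simp [abs_of_pos hl]
  · have hj0 : (j : ℂ) ≠ 0 := Nat.cast_ne_zero.2 hj.ne'
    have hj1 : (1 : ℝ) ≤ j := by exact_mod_cast hj
    have hd : Metric.infDist h (poleSet l) ≤ ‖h - l / j‖ := by
      rw [← dist_eq_norm]
      exact Metric.infDist_le_dist_of_mem (Or.inr ⟨j, hj, rfl⟩)
    have e : ‖(l : ℂ) - j * h‖ = j * ‖h - l / j‖ := by
      have : (l : ℂ) - j * h = -(j * (h - l / j)) := by field_simp; ring
      rw [this, norm_neg, norm_mul, Complex.norm_natCast]
    rw [e]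
    have h0 : 0 ≤ Metric.infDist h (poleSet l) := Metric.infDist_nonneg
    have h1 : min l (δ / 2) ≤ Metric.infDist h (poleSet l) / 2 :=
      (min_le_right _ _).trans (by linarith)
    calc min l (δ / 2) * (j + 1) ≤ Metric.infDist h (poleSet l) / 2 * (j + 1) :=
          mul_le_mul_of_nonneg_right h1 (by positivity)
      _ ≤ Metric.infDist h (poleSet l) * j := by nlinarith
      _ ≤ j * ‖h - l / j‖ := by rw [mul_comm]; exact mul_le_mul_of_nonneg_left hd (by positivity)

theorem exists_norm_starCoeff_le {l : ℝ} (hl : 0 < l) {h : ℂ} (hh : h ∉ poleSet l) :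
    ∃ r > 0, ∃ M : ℝ, 0 ≤ M ∧ ∀ h' ∈ Metric.closedBall h r, h' ∉ poleSet l ∧
      ∀ n, ‖starCoeff l h' n‖ ≤ M ^ n / (n.factorial : ℝ) ^ 2 := by
  have hne : (poleSet l).Nonempty := ⟨0, Or.inl rfl⟩
  set δ := Metric.infDist h (poleSet l) with hδ
  have hδ0 : 0 < δ := ((isClosed_poleSet l).notMem_iff_infDist_pos hne).1 hh
  set c := min l (δ / 2 / 2)
  have hc : 0 < c := lt_min hl (by positivity)
  -- Every point of the disc of radius `δ / 2` keeps distance `δ / 2` from the poles, hence the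
  -- second halving in `c`; the numerator of `M` bounds `‖h'‖`.
  refine ⟨δ / 2, by positivity, (‖h‖ + δ) / c, by positivity, fun h' hh' => ?_⟩
  have hd : δ / 2 ≤ Metric.infDist h' (poleSet l) := by
    have := Metric.infDist_le_infDist_add_dist (s := poleSet l) (x := h) (y := h')
    rw [dist_comm] at this
    have h2 : dist h' h ≤ δ / 2 := hh'
    linarith
  refine ⟨((isClosed_poleSet l).notMem_iff_infDist_pos hne).2 (by linarith), fun n => ?_⟩
  have hnorm : ‖h'‖ ≤ ‖h‖ + δ := by
    have h2 : ‖h' - h‖ ≤ δ / 2 := by rw [← dist_eq_norm]; exact hh'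
    have := norm_sub_norm_le h' h
    linarith
  have hprod : c ^ n * n.factorial ≤ ∏ j ∈ Finset.range n, ‖(l : ℂ) - j * h'‖ := by
    rw [← Finset.prod_range_add_one_eq_factorial, Nat.cast_prod]
    conv_lhs => rw [← Finset.card_range n, ← Finset.prod_const, Finset.card_range,
      ← Finset.prod_mul_distrib]
    refine Finset.prod_le_prod (fun j _ => by positivity) fun j _ => ?_
    push_cast
    exact le_norm_sub_mul hl hd j
  rw [starCoeff, norm_div, norm_mul, norm_mul, norm_pow, norm_neg, norm_one, one_pow, one_mul,
    norm_pow, norm_prod, Complex.norm_natCast, div_pow, div_div]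
  have hn : (0 : ℝ) < n.factorial := by positivity
  refine div_le_div₀ (by positivity) (pow_le_pow_left₀ (norm_nonneg _) hnorm n)
    (by positivity) ?_
  calc c ^ n * (n.factorial : ℝ) ^ 2 = n.factorial * (c ^ n * n.factorial) := by ring
    _ ≤ _ := mul_le_mul_of_nonneg_left hprod hn.le

/-! ## Left invariant vector fields and restriction -/

open scoped Matrix.Norms.Operator in
theorem hasDerivAt_mul_expSU (E : su2) (k : SU2) (i j : Fin 2) :
    HasDerivAt (fun t : ℝ => (k * expSU (t • E)).1 i j) ((k.1 * E.1) i j) 0 := by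
  have h : HasDerivAt (fun t : ℝ => NormedSpace.exp (t • E.1)) E.1 0 := by
    have h0 := hasDerivAt_exp_smul_const (𝕂 := ℝ) E.1 (0 : ℝ)
    rw [zero_smul, NormedSpace.exp_zero, one_mul] at h0
    exact h0
  let L : Matrix (Fin 2) (Fin 2) ℂ →ₗ[ℝ] ℂ :=
    { toFun := fun M => (k.1 * M) i j
      map_add' := fun M N => by rw [mul_add, Matrix.add_apply]
      map_smul' := fun c M => by rw [Matrix.mul_smul, Matrix.smul_apply, RingHom.id_apply] }
  exact (LinearMap.toContinuousLinearMap L).hasFDerivAt.comp_hasDerivAt (0 : ℝ) h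

theorem conjTranspose_eq_adjugate (k : SU2) : k.1ᴴ = k.1.adjugate := by
  have h1 : k.1ᴴ * k.1 = 1 := (Matrix.mem_unitaryGroup_iff'.1
    (Matrix.mem_specialUnitaryGroup_iff.1 k.2).1)
  have h2 := Matrix.mul_adjugate k.1
  rw [(Matrix.mem_specialUnitaryGroup_iff.1 k.2).2, one_smul] at h2
  exact left_inv_eq_right_inv h1 h2

theorem SU2.apply_one_one (k : SU2) : k.1 1 1 = star (k.1 0 0) := by
  have h := conjTranspose_eq_adjugate k
  rw [Matrix.adjugate_fin_two] at h
  simpa using (congrFun (congrFun h 0) 0).symm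

theorem SU2.apply_zero_one (k : SU2) : k.1 0 1 = -star (k.1 1 0) := by
  have h := conjTranspose_eq_adjugate k
  rw [Matrix.adjugate_fin_two] at h
  have := congrFun (congrFun h 0) 1
  simp only [Matrix.conjTranspose_apply, Matrix.of_apply, Matrix.cons_val_zero,
    Matrix.cons_val_one] at this
  rw [this, neg_neg]

/-- The second column of `k` is determined by the first, so the derivative is again linear in the
four coordinates. Skew-Hermitian symmetry of `E` removes the conjugates of its entries, which makes
the formula complex linear in `E` and lets it extend to `sl(2, ℂ)`. -/
theorem hasDerivAt_coord (E : su2) (k : SU2) (i : Fin 4) :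
    HasDerivAt (fun t : ℝ => coord i (k * expSU (t • E)))
      (restrict (polyField E.1 (X i)) k) 0 := by
  have h0 := hasDerivAt_mul_expSU E k 0 0
  have h1 := hasDerivAt_mul_expSU E k 1 0
  have hE00 : star (E.1 0 0) = -E.1 0 0 := congrFun (congrFun E.2.1 0) 0
  have hE10 : star (E.1 1 0) = -E.1 0 1 := congrFun (congrFun E.2.1 0) 1
  rw [Matrix.mul_apply, Fin.sum_univ_two, k.apply_zero_one] at h0
  rw [Matrix.mul_apply, Fin.sum_univ_two, k.apply_one_one] at h1
  have e0 := h0.star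
  have e1 := h1.star
  rw [star_add, star_mul', star_mul', hE00, hE10, star_neg, star_star] at e0
  rw [star_add, star_mul', star_mul', hE00, hE10, star_star] at e1
  have f0 : restrict (polyField E.1 (X 0)) k = E.1 0 0 * k.1 0 0 - E.1 1 0 * star (k.1 1 0) := by
    simp [polyField, mkDerivation_X, restrict, coord]
  have f1 : restrict (polyField E.1 (X 1)) k = E.1 0 1 * k.1 1 0 - E.1 0 0 * star (k.1 0 0) := by
    simp [polyField, mkDerivation_X, restrict, coord]
  have f2 : restrict (polyField E.1 (X 2)) k = E.1 0 0 * k.1 1 0 + E.1 1 0 * star (k.1 0 0) := by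
    simp [polyField, mkDerivation_X, restrict, coord]
  have f3 : restrict (polyField E.1 (X 3)) k =
      -(E.1 0 0 * star (k.1 1 0)) - E.1 0 1 * k.1 0 0 := by
    simp [polyField, mkDerivation_X, restrict, coord]
  fin_cases i
  · exact h0.congr_deriv (Eq.trans (by ring) f0.symm)
  · exact e0.congr_deriv (Eq.trans (by ring) f1.symm)
  · exact h1.congr_deriv (Eq.trans (by ring) f2.symm)
  · exact e1.congr_deriv (Eq.trans (by ring) f3.symm)

theorem expSU_zero : expSU 0 = 1 := by
  apply Subtype.ext
  simp [expSU]

theorem hasDerivAt_restrict (E : su2) (k : SU2) (P : PolC2) :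
    HasDerivAt (fun t : ℝ => restrict P (k * expSU (t • E)))
      (restrict (polyField E.1 P) k) 0 := by
  induction P using MvPolynomial.induction_on with
  | C a =>
    simpa [restrict] using hasDerivAt_const (0 : ℝ) a
  | add P Q hP hQ =>
    simp only [map_add, Pi.add_apply]
    exact hP.add hQ
  | mul_X P i hP =>
    have h := hP.mul (hasDerivAt_coord E k i)
    rw [zero_smul, expSU_zero, mul_one] at h
    have hX : restrict (X i) = coord i := by simp [restrict]
    simp only [map_mul, hX, Pi.mul_apply]
    refine h.congr_deriv ?_
    rw [Derivation.leibniz]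
    simp only [smul_eq_mul, map_add, map_mul, Pi.add_apply, Pi.mul_apply, hX]
    ring

theorem leftFieldC_restrict (Z : Matrix (Fin 2) (Fin 2) ℂ) (hZ : Z.trace = 0) (P : PolC2) :
    leftFieldC Z hZ (restrict P) = restrict (polyField Z P) := by
  funext k
  conv_rhs => rw [← partE_add_I_smul_partF Z hZ, polyField_add_I_smul]
  simp only [leftFieldC, leftField, (hasDerivAt_restrict _ k P).deriv, Derivation.add_apply,
    Derivation.smul_apply, map_add, map_smul, Pi.add_apply, Pi.smul_apply, smul_eq_mul]

theorem leftX_iterate_restrict (n : ℕ) (P : PolC2) :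
    leftX^[n] (restrict P) = restrict (polyX^[n] P) := by
  refine (Function.Semiconj.iterate_right (f := restrict) (ga := polyX) (gb := leftX)
    (fun P => ?_) n P).symm
  rw [← polyField_X]
  exact (leftFieldC_restrict _ _ P).symm

theorem leftY_iterate_restrict (n : ℕ) (P : PolC2) :
    leftY^[n] (restrict P) = restrict (polyY^[n] P) := by
  refine (Function.Semiconj.iterate_right (f := restrict) (ga := polyY) (gb := leftY)
    (fun P => ?_) n P).symm
  rw [← polyField_Y]
  exact (leftFieldC_restrict _ _ P).symm

/-! ## The star product on polynomials -/

/-- The star product on the polynomials on `ℂ²`. -/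
def polyStar (l : ℝ) (h : ℂ) : PolC2 →ₗ[ℂ] PolC2 →ₗ[ℂ] PolC2 :=
  bidiff fun n => starCoeff l h n • LinearMap.id

theorem polyStar_apply (l : ℝ) (h : ℂ) (P Q : PolC2) {N : ℕ} (hN : P.totalDegree < N) :
    polyStar l h P Q =
      ∑ n ∈ Finset.range N, starCoeff l h n • (polyY^[n] P * polyX^[n] Q) :=
  bidiff_apply _ P Q hN

/-- `Y ^ n` shifts the circle weight by `-2 n` and `X ^ n` by `2 n`, so each product has weight
zero. -/
theorem polyStar_mem_InvC2 (l : ℝ) (h : ℂ) {P Q : PolC2} (hP : P ∈ InvC2) (hQ : Q ∈ InvC2) :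
    polyStar l h P Q ∈ InvC2 := by
  rw [mem_InvC2_iff] at hP hQ
  have hX : ∀ n : ℕ, (polyX^[n] Q).IsWeightedHomogeneous circleWeight (2 * n) := by
    intro n
    induction n with
    | zero => simpa using hQ
    | succ n ih =>
      rw [Function.iterate_succ_apply']
      convert isWeightedHomogeneous_polyX ih using 1
      push_cast
      ring
  have hY : ∀ n : ℕ, (polyY^[n] P).IsWeightedHomogeneous circleWeight (-(2 * n)) := by
    intro n
    induction n with
    | zero => simpa using hP
    | succ n ih =>
      rw [Function.iterate_succ_apply']
      convert isWeightedHomogeneous_polyY ih using 1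
      push_cast
      ring
  rw [polyStar_apply l h P Q (Nat.lt_succ_self _)]
  refine sum_mem fun n _ => InvC2.smul_mem ?_ _
  rw [mem_InvC2_iff]
  convert (hY n).mul (hX n) using 1
  ring

theorem starLift_eq_sum (l : ℝ) (h : ℂ) {p q : Pol l} {P Q : PolC2} (hP : restrict P = pull l p)
    (hQ : restrict Q = pull l q) (k : SU2) {N : ℕ} (hN : P.totalDegree < N) :
    starLift l h p q k =
      ∑ n ∈ Finset.range N, starCoeff l h n * restrict (polyY^[n] P * polyX^[n] Q) k := by
  simp only [starLift, ← hP, ← hQ, leftX_iterate_restrict, leftY_iterate_restrict, map_mul,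
    Pi.mul_apply, mul_assoc]
  refine tsum_eq_sum fun n hn => ?_
  rw [polyY_iterate_eq_zero (hN.trans_le (by simpa using hn))]
  simp

theorem starLift_eq_restrict (l : ℝ) (h : ℂ) {p q : Pol l} {P Q : PolC2}
    (hP : restrict P = pull l p) (hQ : restrict Q = pull l q) :
    starLift l h p q = restrict (polyStar l h P Q) := by
  funext k
  rw [starLift_eq_sum l h hP hQ k (Nat.lt_succ_self _),
    polyStar_apply l h P Q (Nat.lt_succ_self _), map_sum, Finset.sum_apply]
  simp only [map_smul, Pi.smul_apply, smul_eq_mul]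

theorem psi_surjective (l : ℝ) : Function.Surjective (psi l) := by
  rintro ⟨_, k, rfl⟩
  exact ⟨k, rfl⟩

theorem pull_injective (l : ℝ) : Function.Injective (pull l) :=
  (psi_surjective l).injective_comp_right

theorem psi_apply (l : ℝ) (k : SU2) : (psi l k).1 = (Complex.I * (l : ℂ) / 8) •
    !![fA k, 2 * fC k; 2 * fB k, -fA k] := by
  have hinv : ((k⁻¹ : SU2) : Matrix (Fin 2) (Fin 2) ℂ) = k.1.adjugate :=
    conjTranspose_eq_adjugate k
  change k.1 * basePoint l * ((k⁻¹ : SU2) : Matrix (Fin 2) (Fin 2) ℂ) = _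
  rw [hinv, basePoint, Matrix.adjugate_fin_two, k.apply_zero_one, k.apply_one_one]
  ext i j
  fin_cases i <;> fin_cases j <;>
    simp [Matrix.mul_apply, Fin.sum_univ_two, fA, fB, fC, coord, k.apply_zero_one,
      k.apply_one_one] <;> ring

theorem pullPol_injective (l : ℝ) : Function.Injective (pullPol l) := fun _ _ h =>
  Subtype.ext (pull_injective l (congrArg Subtype.val h))

/-- The generators `fA`, `fB`, `fC` are matrix entries of `psi l k` up to a scalar, which is
invertible because `l ≠ 0`. -/
theorem pullPol_surjective {l : ℝ} (hl : l ≠ 0) : Function.Surjective (pullPol l) := by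
  set c : ℂ := Complex.I * (l : ℂ) / 8 with hc
  have hc0 : c ≠ 0 := by simp [hc, hl]
  have hentry : ∀ (i j : Fin 2) (a : ℂ), ∃ p : Pol l, ∀ x : Sphere l, p.1 x = a * x.1 i j := by
    intro i j a
    refine ⟨⟨fun x => a * x.1 i j, Algebra.subset_adjoin
      ⟨{ toFun := fun M => a * M i j
         map_add' := fun M N => by rw [Matrix.add_apply, mul_add]
         map_smul' := fun r M => ?_ }, fun x => rfl⟩⟩, fun x => rfl⟩
    rw [Matrix.smul_apply, mul_smul_comm, RingHom.id_apply]
  have hgen : {fA, fB, fC} ⊆ (((pull l).comp (Pol l).val).range : Set (SU2 → ℂ)) := by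
    rintro f (rfl | rfl | rfl)
    · obtain ⟨p, hp⟩ := hentry 0 0 c⁻¹
      refine ⟨p, funext fun k => (hp (psi l k)).trans ?_⟩
      simp [psi_apply, ← hc, hc0]
    · obtain ⟨p, hp⟩ := hentry 1 0 (2 * c)⁻¹
      refine ⟨p, funext fun k => (hp (psi l k)).trans ?_⟩
      simp only [psi_apply, ← hc, Matrix.smul_apply, Matrix.of_apply, Matrix.cons_val_zero,
        Matrix.cons_val_one, smul_eq_mul]
      field_simp
    · obtain ⟨p, hp⟩ := hentry 0 1 (2 * c)⁻¹
      refine ⟨p, funext fun k => (hp (psi l k)).trans ?_⟩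
      simp only [psi_apply, ← hc, Matrix.smul_apply, Matrix.of_apply, Matrix.cons_val_zero,
        Matrix.cons_val_one, smul_eq_mul]
      field_simp
  rintro ⟨f, hf⟩
  obtain ⟨p, hp⟩ := Algebra.adjoin_le hgen hf
  exact ⟨p, Subtype.ext hp⟩

/-- The polynomial on the sphere defined by an invariant polynomial on `ℂ²`. -/
def toPol {l : ℝ} (hl : l ≠ 0) : InvC2 →ₐ[ℂ] Pol l :=
  ((AlgEquiv.ofBijective (pullPol l) ⟨pullPol_injective l, pullPol_surjective hl⟩).symm :
    InvSU →ₐ[ℂ] Pol l).comp restrictInv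

theorem pullPol_toPol {l : ℝ} (hl : l ≠ 0) (P : InvC2) : pullPol l (toPol hl P) = restrictInv P :=
  (AlgEquiv.ofBijective (pullPol l)
    ⟨pullPol_injective l, pullPol_surjective hl⟩).apply_symm_apply (restrictInv P)

theorem pull_toPol {l : ℝ} (hl : l ≠ 0) (P : InvC2) : pull l (toPol hl P) = restrict P :=
  congrArg Subtype.val (pullPol_toPol hl P)

theorem toPol_surjective {l : ℝ} (hl : l ≠ 0) : Function.Surjective (toPol hl) := by
  intro p
  obtain ⟨P, hP⟩ := restrictInv_surjective (pullPol l p)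
  exact ⟨P, pullPol_injective l (by rw [pullPol_toPol, hP])⟩

/-- The star product on the invariant polynomials on `ℂ²`. -/
def invStar (l : ℝ) (h : ℂ) (P Q : InvC2) : InvC2 :=
  ⟨polyStar l h P Q, polyStar_mem_InvC2 l h P.2 Q.2⟩

theorem pull_toPol_invStar {l : ℝ} (hl : l ≠ 0) (h : ℂ) (P Q : InvC2) :
    pull l (toPol hl (invStar l h P Q)) = starLift l h (toPol hl P) (toPol hl Q) := by
  rw [pull_toPol, starLift_eq_restrict l h (pull_toPol hl P).symm (pull_toPol hl Q).symm]
  rfl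

/-- Invariant lifts of `p` and `q` produce an actual polynomial, so the default value `0` in
`starProd` is never taken. -/
theorem pull_starProd {l : ℝ} (hl : l ≠ 0) (h : ℂ) (p q : Pol l) :
    pull l (starProd l h p q) = starLift l h p q := by
  have hr : ∃ r : Pol l, pull l r = starLift l h p q := by
    obtain ⟨P, rfl⟩ := toPol_surjective hl p
    obtain ⟨Q, rfl⟩ := toPol_surjective hl q
    exact ⟨_, pull_toPol_invStar hl h P Q⟩
  rw [starProd, dif_pos hr]
  exact hr.choose_spec

theorem starProd_toPol {l : ℝ} (hl : l ≠ 0) (h : ℂ) (P Q : InvC2) :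
    starProd l h (toPol hl P) (toPol hl Q) = toPol hl (invStar l h P Q) := by
  refine Subtype.ext (pull_injective l ?_)
  rw [pull_starProd hl, pull_toPol_invStar]

/-! ## Continuity -/

/-- A quotient homomorphism of topological groups is open. Openness is what is needed in two
variables: products of open quotient maps are again quotient maps. -/
theorem isOpenQuotientMap_toPol {l : ℝ} (hl : l ≠ 0) (R : ℝ) :
    letI := subTopology R
    IsOpenQuotientMap fun P : InvC2 => PolTR.of l R (toPol hl P) := by
  let _ : TopologicalSpace InvC2 := subTopology R
  have : IsTopologicalAddGroup InvC2 := isTopologicalAddGroup_sub R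
  let φ : InvC2 →+ PolTR l R := (toPol hl : InvC2 →+ Pol l)
  have hφ : Topology.IsQuotientMap φ := by
    refine ⟨⟨?_⟩, toPol_surjective hl⟩
    let e : Pol l ≃ InvSU :=
      Equiv.ofBijective (pullPol l) ⟨pullPol_injective l, pullPol_surjective hl⟩
    change (quotTopology R).induced e = (subTopology R).coinduced (e.symm ∘ restrictInv)
    rw [← coinduced_compose, ← Equiv.coinduced_symm]
  exact AddMonoidHom.isOpenQuotientMap_of_isQuotientMap hφ

/-- A map on pairs of polynomials on the sphere is continuous if it comes from a suitably bounded
bilinear map on the polynomials on `ℂ²`. -/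
theorem continuous_of_comp_toPol {l : ℝ} (hl : l ≠ 0) (R : ℝ) {E : Type*} [TopologicalSpace E]
    (B : PolTR l R → PolTR l R → E)
    (hB : letI := subTopology R
      Continuous fun z : InvC2 × InvC2 =>
        B (PolTR.of l R (toPol hl z.1)) (PolTR.of l R (toPol hl z.2))) :
    Continuous fun z : PolTR l R × PolTR l R => B z.1 z.2 := by
  let _ : TopologicalSpace InvC2 := subTopology R
  have h := isOpenQuotientMap_toPol hl R
  exact (h.prodMap h).continuous_comp_iff.1 hB

theorem continuous_comp_val (R : ℝ) {E : Type*} [TopologicalSpace E] (F : PolC2 → PolC2 → E)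
    (hF : letI := trTopology R
      Continuous fun z : PolC2 × PolC2 => F z.1 z.2) :
    letI := subTopology R
    Continuous fun z : InvC2 × InvC2 => F z.1 z.2 := by
  let _ : TopologicalSpace PolC2 := trTopology R
  let _ : TopologicalSpace InvC2 := subTopology R
  have hv : Continuous (Subtype.val : InvC2 → PolC2) := continuous_induced_dom
  exact hF.comp (hv.prodMap hv)

theorem continuous_polyStar {l R : ℝ} (hl : 0 < l) (hR : 0 ≤ R) {h : ℂ} (hh : h ∉ poleSet l) :
    letI := trTopology R
    Continuous fun z : PolC2 × PolC2 => polyStar l h z.1 z.2 := by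
  let _ : TopologicalSpace PolC2 := trTopology R
  obtain ⟨r, hr, M, hM, hb⟩ := exists_norm_starCoeff_le hl hh
  refine continuous_of_le_trSeminorm (withSeminorms_trTopology R) R _ fun C => ?_
  refine exists_bidiff_le hR _ _ hM C fun n P => ?_
  rw [LinearMap.smul_apply, LinearMap.id_apply, map_smul_eq_mul]
  exact mul_le_mul_of_nonneg_right ((hb h (Metric.mem_closedBall_self hr.le)).2 n)
    (apply_nonneg _ _)

theorem continuous_starProd {l R : ℝ} (hl : 0 < l) (hR : 0 ≤ R) {h : ℂ} (hh : h ∉ poleSet l) :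
    Continuous fun z : PolTR l R × PolTR l R =>
      PolTR.of l R (starProd l h z.1.toPol z.2.toPol) := by
  refine continuous_of_comp_toPol hl.ne' R
    (fun p q => PolTR.of l R (starProd l h p.toPol q.toPol)) ?_
  let _ : TopologicalSpace InvC2 := subTopology R
  have hs : Continuous fun z : InvC2 × InvC2 => invStar l h z.1 z.2 :=
    continuous_induced_rng.2 (let _ := trTopology R
      continuous_comp_val R (fun P Q => polyStar l h P Q) (continuous_polyStar hl hR hh))
  convert (isOpenQuotientMap_toPol hl.ne' R).continuous.comp hs using 1
  funext z
  exact congrArg (PolTR.of l R) (starProd_toPol hl.ne' h z.1 z.2)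

theorem norm_coord_le (i : Fin 4) (k : SU2) : ‖coord i k‖ ≤ 1 := by
  have hk := (Matrix.mem_specialUnitaryGroup_iff.1 k.2).1
  have h := entry_norm_bound_of_unitary hk
  fin_cases i
  · exact h 0 0
  · simpa [coord] using h 0 0
  · exact h 1 0
  · simpa [coord] using h 1 0

/-- Entries of unitary matrices, and hence all monomials in them, have absolute value at most one,
while the weights `(d!) ^ R` are at least one. -/
theorem norm_restrict_le {R : ℝ} (hR : 0 ≤ R) (k : SU2) (P : PolC2) :
    ‖restrict P k‖ ≤ trSeminorm R ⟨1, Set.self_mem_Ici⟩ P := by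
  let ev : PolC2 →ₗ[ℂ] ℂ := LinearMap.proj k ∘ₗ restrict.toLinearMap
  have := seminorm_le_trSeminorm (normSeminorm ℂ ℂ) ev R ⟨1, Set.self_mem_Ici⟩ 1 (fun I => ?_) P
  · simpa [ev] using this
  · rw [trSeminorm_monomial]
    have h1 : ‖restrict (monomial I 1) k‖ ≤ 1 := by
      rw [restrict, aeval_monomial, map_one, one_mul, Finsupp.prod, Finset.prod_apply, norm_prod]
      refine Finset.prod_le_one (fun i _ => norm_nonneg _) fun i _ => ?_
      rw [Pi.pow_apply, norm_pow]
      exact pow_le_one₀ (norm_nonneg _) (norm_coord_le i k)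
    have h2 : (1 : ℝ) ≤ (I.degree.factorial : ℝ) ^ R :=
      Real.one_le_rpow (by exact_mod_cast Nat.one_le_iff_ne_zero.2 (Nat.factorial_ne_zero _)) hR
    simpa [ev] using h1.trans h2

theorem continuous_eval {l R : ℝ} (hl : l ≠ 0) (hR : 0 ≤ R) (x : Sphere l) :
    Continuous fun p : PolTR l R => p.toPol.1 x := by
  let _ : TopologicalSpace PolC2 := trTopology R
  let _ : TopologicalSpace InvC2 := subTopology R
  obtain ⟨k, rfl⟩ := psi_surjective l x
  let ev : PolC2 →ₗ[ℂ] ℂ := LinearMap.proj k ∘ₗ restrict.toLinearMap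
  have hc : Continuous ev := by
    refine (withSeminorms_trTopology R).continuous_normedSpace_rng ℂ ev
      ⟨{⟨1, Set.self_mem_Ici⟩}, 1, fun P => ?_⟩
    rw [Finset.sup_singleton, one_smul]
    exact norm_restrict_le hR k P
  refine (isOpenQuotientMap_toPol hl R).continuous_comp_iff.1 ?_
  have hv : Continuous (Subtype.val : InvC2 → PolC2) := continuous_induced_dom
  convert hc.comp hv using 1
  funext P
  exact congrFun (pull_toPol hl P) k

/-! ## Extension to the completion -/

theorem exists_restrict_eq_pull {l : ℝ} (hl : l ≠ 0) (p : Pol l) : ∃ P : PolC2, restrict P = pull l p := by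
  obtain ⟨P, rfl⟩ := toPol_surjective hl p
  exact ⟨P, (pull_toPol hl P).symm⟩

/-- Additivity comes from the bilinear `polyStar`: the fields themselves are defined by `deriv` and
are not additive on arbitrary functions. -/
theorem starLift_add_left {l : ℝ} (hl : l ≠ 0) (h : ℂ) (p p' q : Pol l) :
    starLift l h (p + p') q = starLift l h p q + starLift l h p' q := by
  obtain ⟨P, hP⟩ := exists_restrict_eq_pull hl p
  obtain ⟨P', hP'⟩ := exists_restrict_eq_pull hl p'
  obtain ⟨Q, hQ⟩ := exists_restrict_eq_pull hl q
  have hPP : restrict (P + P') = pull l (p + p' : Pol l) := by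
    rw [map_add, hP, hP', ← map_add]; rfl
  rw [starLift_eq_restrict l h hP hQ, starLift_eq_restrict l h hP' hQ,
    starLift_eq_restrict l h hPP hQ, map_add, LinearMap.add_apply, map_add]

theorem starLift_add_right {l : ℝ} (hl : l ≠ 0) (h : ℂ) (p q q' : Pol l) :
    starLift l h p (q + q') = starLift l h p q + starLift l h p q' := by
  obtain ⟨P, hP⟩ := exists_restrict_eq_pull hl p
  obtain ⟨Q, hQ⟩ := exists_restrict_eq_pull hl q
  obtain ⟨Q', hQ'⟩ := exists_restrict_eq_pull hl q'
  have hQQ : restrict (Q + Q') = pull l (q + q' : Pol l) := by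
    rw [map_add, hQ, hQ', ← map_add]; rfl
  rw [starLift_eq_restrict l h hP hQ, starLift_eq_restrict l h hP hQ',
    starLift_eq_restrict l h hP hQQ, map_add, map_add]

theorem starProd_add_left {l : ℝ} (hl : l ≠ 0) (h : ℂ) (p p' q : Pol l) :
    starProd l h (p + p') q = starProd l h p q + starProd l h p' q := by
  refine Subtype.ext (pull_injective l ?_)
  rw [pull_starProd hl, starLift_add_left hl, ← pull_starProd hl, ← pull_starProd hl, ← map_add]
  rfl

theorem starProd_add_right {l : ℝ} (hl : l ≠ 0) (h : ℂ) (p q q' : Pol l) :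
    starProd l h p (q + q') = starProd l h p q + starProd l h p q' := by
  refine Subtype.ext (pull_injective l ?_)
  rw [pull_starProd hl, starLift_add_right hl, ← pull_starProd hl, ← pull_starProd hl, ← map_add]
  rfl

/-- The bundled form of a map that is additive in each of its two variables. -/
def biadditive {A G : Type*} [AddCommGroup A] [AddCommGroup G] (B : A → A → G)
    (hl : ∀ p p' q, B (p + p') q = B p q + B p' q)
    (hr : ∀ p q q', B p (q + q') = B p q + B p q') : A →+ A →+ G :=
  AddMonoidHom.mk' (fun p => AddMonoidHom.mk' (B p) (hr p)) fun p p' =>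
    AddMonoidHom.ext (hl p p')

/-- A continuous biadditive map extends to the completion. -/
theorem continuous_extend_biadditive {A G : Type*} [UniformSpace A] [AddCommGroup A]
    [IsUniformAddGroup A] [UniformSpace G] [AddCommGroup G] [IsUniformAddGroup G] [T0Space G]
    [CompleteSpace G] (φ : A →+ A →+ G) (hφ : Continuous fun z : A × A => φ z.1 z.2) :
    Continuous (((UniformSpace.Completion.isDenseInducing_coe (α := A)).prodMap
      (UniformSpace.Completion.isDenseInducing_coe (α := A))).extend
        fun z : A × A => φ z.1 z.2) := by
  have de : IsDenseInducing (UniformSpace.Completion.toCompl : A →+ UniformSpace.Completion A) :=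
    UniformSpace.Completion.isDenseInducing_coe
  -- A continuous biadditive map need not be uniformly continuous, so the extension theorem for
  -- biadditive maps takes the place of the one for uniformly continuous maps.
  have h := IsDenseInducing.extend_Z_bilin de de hφ
  exact h

theorem continuous_toHat_starProd {l R : ℝ} (hl : 0 < l) (hR : 0 ≤ R) {h : ℂ}
    (hh : h ∉ poleSet l) : Continuous fun z : PolTR l R × PolTR l R =>
      toHat l R (starProd l h z.1.toPol z.2.toPol) :=
  (UniformSpace.Completion.continuous_coe (PolTR l R)).comp (continuous_starProd hl hR hh)

theorem continuous_starHat {l R : ℝ} (hl : 0 < l) (hR : 0 ≤ R) {h : ℂ} (hh : h ∉ poleSet l) :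
    Continuous fun z : PolHat l R × PolHat l R => starHat l R h z.1 z.2 := by
  have hl' : ∀ p p' q : PolTR l R, toHat l R (starProd l h (p + p').toPol q.toPol) =
      toHat l R (starProd l h p.toPol q.toPol) + toHat l R (starProd l h p'.toPol q.toPol) :=
    fun p p' q =>
      (congrArg (toHat l R) (starProd_add_left hl.ne' h p.toPol p'.toPol q.toPol)).trans
        (UniformSpace.Completion.coe_add _ _)
  have hr' : ∀ p q q' : PolTR l R, toHat l R (starProd l h p.toPol (q + q').toPol) =
      toHat l R (starProd l h p.toPol q.toPol) + toHat l R (starProd l h p.toPol q'.toPol) :=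
    fun p q q' =>
      (congrArg (toHat l R) (starProd_add_right hl.ne' h p.toPol q.toPol q'.toPol)).trans
        (UniformSpace.Completion.coe_add _ _)
  exact continuous_extend_biadditive (biadditive
    (fun p q : PolTR l R => toHat l R (starProd l h p.toPol q.toPol)) hl' hr')
    (continuous_toHat_starProd hl hR hh)

theorem starHat_toHat {l R : ℝ} (hl : 0 < l) (hR : 0 ≤ R) {h : ℂ} (hh : h ∉ poleSet l)
    (p q : Pol l) : starHat l R h (toHat l R p) (toHat l R q) = toHat l R (starProd l h p q) :=
  ((UniformSpace.Completion.isDenseInducing_coe (α := PolTR l R)).prodMap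
    (UniformSpace.Completion.isDenseInducing_coe (α := PolTR l R))).extend_eq
      (continuous_toHat_starProd hl hR hh) (PolTR.of l R p, PolTR.of l R q)

theorem evalHat_toHat {l R : ℝ} (hl : l ≠ 0) (hR : 0 ≤ R) (x : Sphere l) (p : Pol l) :
    evalHat l R x (toHat l R p) = p.1 x :=
  (UniformSpace.Completion.isDenseInducing_coe (α := PolTR l R)).extend_eq
    (continuous_eval hl hR x) (PolTR.of l R p)

theorem continuous_evalHat {l R : ℝ} (hl : l ≠ 0) (hR : 0 ≤ R) (x : Sphere l) :
    Continuous (evalHat l R x) := by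
  let g : PolTR l R →+ ℂ := AddMonoidHom.mk' (fun p => p.toPol.1 x) fun p q => rfl
  have hg : UniformContinuous g :=
    uniformContinuous_addMonoidHom_of_continuous (continuous_eval hl hR x)
  have h : evalHat l R x = UniformSpace.Completion.extension g :=
    (UniformSpace.Completion.isDenseInducing_coe (α := PolTR l R)).extend_unique
      (fun p => UniformSpace.Completion.extension_coe hg p)
      UniformSpace.Completion.continuous_extension
  rw [h]
  exact UniformSpace.Completion.continuous_extension

/-! ## Holomorphic dependence on the deformation parameter -/

theorem evalHat_starHat_toHat {l R : ℝ} (hl : 0 < l) (hR : 0 ≤ R) {h : ℂ} (hh : h ∉ poleSet l)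
    (p q : Pol l) (k : SU2) :
    evalHat l R (psi l k) (starHat l R h (toHat l R p) (toHat l R q)) = starLift l h p q k := by
  rw [starHat_toHat hl hR hh, evalHat_toHat hl.ne' hR]
  exact congrFun (pull_starProd hl.ne' h p q) k

theorem differentiableAt_starLift {l : ℝ} (hl : 0 < l) (p q : Pol l) (k : SU2) {h : ℂ}
    (hh : h ∉ poleSet l) : DifferentiableAt ℂ (fun h => starLift l h p q k) h := by
  obtain ⟨P, hP⟩ := exists_restrict_eq_pull hl.ne' p
  obtain ⟨Q, hQ⟩ := exists_restrict_eq_pull hl.ne' q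
  simp only [fun h => starLift_eq_sum l h hP hQ k (Nat.lt_succ_self _)]
  exact DifferentiableAt.fun_sum fun n _ => (differentiableAt_starCoeff hl n hh).mul_const _

/-- The function `ħ ↦ F_ħ(p, q)(k)` on a compact set of parameters. -/
def starLiftOn {l : ℝ} (hl : 0 < l) (k : SU2) {K : Set ℂ} (hK : ∀ h ∈ K, h ∉ poleSet l)
    (p q : Pol l) : C(K, ℂ) where
  toFun h := starLift l h p q k
  continuous_toFun := by
    have : ContinuousOn (fun h => starLift l h p q k) K := fun h hh =>
      (differentiableAt_starLift hl p q k (hK h hh)).continuousAt.continuousWithinAt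
    exact this.domRestrict

/-- The coefficient bound is uniform on `K`, so it bounds the sup norms of the coefficient functions
and `exists_bidiff_le` applies with values in `C(K, ℂ)`. -/
theorem continuous_starLiftOn {l R : ℝ} (hl : 0 < l) (hR : 0 ≤ R) (k : SU2) {K : Set ℂ}
    [CompactSpace K] (hK : ∀ h ∈ K, h ∉ poleSet l) {M : ℝ} (hM : 0 ≤ M)
    (hb : ∀ h ∈ K, ∀ n, ‖starCoeff l h n‖ ≤ M ^ n / (n.factorial : ℝ) ^ 2) :
    Continuous fun z : PolTR l R × PolTR l R => starLiftOn hl k hK z.1.toPol z.2.toPol := by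
  refine continuous_of_comp_toPol hl.ne' R
    (fun p q => starLiftOn hl k hK p.toPol q.toPol) ?_
  let c : ℕ → C(K, ℂ) := fun n => ⟨fun h => starCoeff l h n, by
    have : ContinuousOn (fun h => starCoeff l h n) K := fun h hh =>
      (differentiableAt_starCoeff hl n (hK h hh)).continuousAt.continuousWithinAt
    exact this.domRestrict⟩
  have hc : ∀ n, ‖c n‖ ≤ M ^ n / (n.factorial : ℝ) ^ 2 := fun n =>
    (ContinuousMap.norm_le _ (by positivity)).2 fun h => hb h h.2 n
  let T : ℕ → PolC2 →ₗ[ℂ] C(K, ℂ) := fun n =>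
    (LinearMap.proj k ∘ₗ restrict.toLinearMap : PolC2 →ₗ[ℂ] ℂ).smulRight (c n)
  have hT : ∀ n P, T n P = restrict P k • c n := fun n P => rfl
  let _ : TopologicalSpace InvC2 := subTopology R
  have hF : letI := trTopology R
      Continuous fun z : PolC2 × PolC2 => bidiff T z.1 z.2 := by
    refine continuous_of_le_trSeminorm (norm_withSeminorms ℂ C(K, ℂ)) R _ fun _ => ?_
    refine exists_bidiff_le hR _ _ hM ⟨1, Set.self_mem_Ici⟩ fun n P => ?_
    rw [hT, coe_normSeminorm, norm_smul, mul_comm]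
    exact mul_le_mul (hc n) (norm_restrict_le hR k P) (norm_nonneg _) (by positivity)
  convert continuous_comp_val R (fun P Q => bidiff T P Q) hF using 1
  funext z
  ext h
  have h1 := pull_toPol hl.ne' z.1
  have h2 := pull_toPol hl.ne' z.2
  refine (starLift_eq_sum l h h1.symm h2.symm k (Nat.lt_succ_self _)).trans ?_
  rw [bidiff_apply T _ _ (Nat.lt_succ_self _), ContinuousMap.sum_apply]
  refine Finset.sum_congr rfl fun n _ => ?_
  rw [hT, ContinuousMap.smul_apply, smul_eq_mul, mul_comm]
  rfl

/-- Weierstrass' theorem on a disc around `h₀`, with polynomials tending to `p` and `q` as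
approximants. -/
theorem differentiableAt_evalHat_starHat {l R : ℝ} (hl : 0 < l) (hR : 0 ≤ R) (p q : PolHat l R)
    (x : Sphere l) {h₀ : ℂ} (hh₀ : h₀ ∉ poleSet l) :
    DifferentiableAt ℂ (fun h => evalHat l R x (starHat l R h p q)) h₀ := by
  obtain ⟨k, rfl⟩ := psi_surjective l x
  obtain ⟨r, hr, M, hM, hb⟩ := exists_norm_starCoeff_le hl hh₀
  set K := Metric.closedBall h₀ r
  have hK : ∀ h ∈ K, h ∉ poleSet l := fun h hh => (hb h hh).1
  have : CompactSpace K := isCompact_iff_compactSpace.1 (isCompact_closedBall h₀ r)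
  have hcont := continuous_starLiftOn (R := R) hl hR k hK hM fun h hh => (hb h hh).2
  have di := (UniformSpace.Completion.isDenseInducing_coe (α := PolTR l R)).prodMap
    (UniformSpace.Completion.isDenseInducing_coe (α := PolTR l R))
  set Φ : PolHat l R × PolHat l R → C(K, ℂ) :=
    di.extend fun z : PolTR l R × PolTR l R => starLiftOn hl k hK z.1.toPol z.2.toPol with hΦ
  have hΦc : Continuous Φ := by
    have hl' : ∀ p p' q : PolTR l R, starLiftOn hl k hK (p + p').toPol q.toPol =
        starLiftOn hl k hK p.toPol q.toPol + starLiftOn hl k hK p'.toPol q.toPol := by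
      intro p p' q
      ext h
      exact congrFun (starLift_add_left hl.ne' h p.toPol p'.toPol q.toPol) k
    have hr' : ∀ p q q' : PolTR l R, starLiftOn hl k hK p.toPol (q + q').toPol =
        starLiftOn hl k hK p.toPol q.toPol + starLiftOn hl k hK p.toPol q'.toPol := by
      intro p q q'
      ext h
      exact congrFun (starLift_add_right hl.ne' h p.toPol q.toPol q'.toPol) k
    exact continuous_extend_biadditive (biadditive
      (fun p q : PolTR l R => starLiftOn hl k hK p.toPol q.toPol) hl' hr') hcont
  have hΦe : ∀ z : PolTR l R × PolTR l R,
      Φ (z.1, z.2) = starLiftOn hl k hK z.1.toPol z.2.toPol := fun z => di.extend_eq hcont z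
  -- For fixed `h` both sides are continuous in `z` and agree on the dense set of pairs of
  -- polynomials.
  have hval : ∀ (h : K) (z : PolHat l R × PolHat l R),
      evalHat l R (psi l k) (starHat l R h z.1 z.2) = Φ z h := by
    intro h
    refine congrFun (di.dense.equalizer ((continuous_evalHat hl.ne' hR _).comp
      (continuous_starHat hl hR (hK h h.2))) ((continuous_eval_const h).comp hΦc) ?_)
    funext z
    refine (evalHat_starHat_toHat hl hR (hK h h.2) z.1.toPol z.2.toPol k).trans ?_
    exact (congrArg (fun f : C(K, ℂ) => f h) (hΦe z)).symm
  -- The approximation runs along the trace of the neighbourhoods of `(p, q)` on pairs of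
  -- polynomials; density makes this filter nontrivial, as the limit theorem requires.
  have hne := di.comap_nhds_neBot (p, q)
  have hlim := ContinuousMap.tendsto_iff_tendstoUniformly.1 ((hΦc.tendsto (p, q)).comp
    (Filter.tendsto_comap (f := Prod.map ((↑) : PolTR l R → PolHat l R) ((↑) : PolTR l R → PolHat l R))))
  have hunif : TendstoUniformlyOn
      (fun (z : PolTR l R × PolTR l R) h => starLift l h z.1.toPol z.2.toPol k)
      (fun h => evalHat l R (psi l k) (starHat l R h p q))
      (Filter.comap (Prod.map ((↑) : PolTR l R → PolHat l R) ((↑) : PolTR l R → PolHat l R))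
        (𝓝 (p, q))) K := by
    rw [tendstoUniformlyOn_iff_tendstoUniformly_comp_coe]
    convert hlim using 1
    · funext z h
      exact (congrArg (fun f : C(K, ℂ) => f h) (hΦe z)).symm
    · funext h
      exact hval h (p, q)
  have hdiff := (hunif.mono Metric.ball_subset_closedBall).tendstoLocallyUniformlyOn.differentiableOn
    (Filter.Eventually.of_forall fun z h hh => (differentiableAt_starLift hl z.1.toPol z.2.toPol k
      (hK h (Metric.ball_subset_closedBall hh))).differentiableWithinAt) Metric.isOpen_ball
  exact hdiff.differentiableAt (Metric.ball_mem_nhds h₀ hr)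

end QuantumSphere

end

theorem theorem5p19 (l R : ℝ) (hl : 0 < l) (hR : 0 ≤ R) :
    (∀ h ∈ (QuantumSphere.poleSet l)ᶜ,
      (∀ p q : QuantumSphere.Pol l,
        QuantumSphere.pull l (QuantumSphere.starProd l h p q) =
          QuantumSphere.starLift l h p q) ∧
      (∀ p q : QuantumSphere.Pol l,
        QuantumSphere.starHat l R h (QuantumSphere.toHat l R p) (QuantumSphere.toHat l R q) =
          QuantumSphere.toHat l R (QuantumSphere.starProd l h p q)) ∧
      Continuous fun pq : QuantumSphere.PolHat l R × QuantumSphere.PolHat l R =>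
        QuantumSphere.starHat l R h pq.1 pq.2) ∧
    (∀ x : QuantumSphere.Sphere l,
      (∀ p : QuantumSphere.Pol l,
        QuantumSphere.evalHat l R x (QuantumSphere.toHat l R p) = (p : _ → ℂ) x) ∧
      Continuous (QuantumSphere.evalHat l R x)) ∧
    ∀ (p q : QuantumSphere.PolHat l R) (x : QuantumSphere.Sphere l),
      DifferentiableOn ℂ
        (fun h : ℂ => QuantumSphere.evalHat l R x (QuantumSphere.starHat l R h p q))
        (QuantumSphere.poleSet l)ᶜ :=
  ⟨fun h hh => ⟨QuantumSphere.pull_starProd hl.ne' h, QuantumSphere.starHat_toHat hl hR hh,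
      QuantumSphere.continuous_starHat hl hR hh⟩,
    fun x => ⟨QuantumSphere.evalHat_toHat hl.ne' hR x, QuantumSphere.continuous_evalHat hl.ne' hR x⟩,
    fun p q x _ hh =>
      (QuantumSphere.differentiableAt_evalHat_starHat hl hR p q x hh).differentiableWithinAt⟩
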